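/- **Expected FLIPD lower bound.** Let $0\le d\le n$ and let $\mathcal M\subset\mathbb R^n$ be a $d$-dimensional embedded submanifold of class at least $C^1$ (every point of $\mathcal M$ has an open neighbourhood $U\subset\mathbb R^n$ with a $C^1$-diffeomorphism $\Phi:U\to V$ onto an open set $V\subset\mathbb R^n$ and a $d$-dimensional linear subspace $L$ such that $\Phi(\mathcal M\cap U)=L\cap V$). Let $\mathbf x$ be a random vector whose law is carried by $\mathcal M$ and has a continuous density $p:\mathcal M\to[0,\infty)$ with respect to the $d$-dimensional Hausdorff measure on $\mathcal M$. For $\sigma>0$ let $\tilde{\mathbf x}_\sigma=\mathbf x+\sigma\boldsymbol\varepsilon$ with $\boldsymbol\varepsilon\sim\mathcal N(0,I_n)$ independent of $\mathbf x$, so that $\tilde{\mathbf x}_\sigma\sim p_{\mathbf x}*\mathcal N(0,\sigma^2I_n)$. For a differentiable score function $s:\mathbb R^n\to\mathbb R^n$ (for instance $s=s_\theta$ with an arbitrary parameter $\theta$) put $$\mathcal L_{\mathrm{ISM}}(x,\sigma,s)=\sigma^2\Big(\nabla\cdot s(x)+\tfrac12\|s(x)\|^2\Big),\qquad \mathrm{FLIPD}(x,\sigma,s)=\mathcal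 L_{\mathrm{ISM}}(x,\sigma,s)+\tfrac{\sigma^2}{2}\|s(x)\|^2+n .$$ Call $s$ admissible at noise level $\sigma$ if it is differentiable and $\mathcal L_{\mathrm{ISM}}(\tilde{\mathbf x}_\sigma,\sigma,s)$ and $\mathrm{FLIPD}(\tilde{\mathbf x}_\sigma,\sigma,s)$ are integrable. 1. If $d<n$, there is $\sigma_0>0$, depending only on the law of $\mathbf x$, such that for all $0<\sigma<\sigma_0$ and all $s$ admissible at noise level $\sigma$, $$\mathbb E\big[\mathrm{FLIPD}(\tilde{\mathbf x}_\sigma,\sigma,s)\big]\ \ge\ \mathbb E\big[\mathcal L_{\mathrm{ISM}}(\tilde{\mathbf x}_\sigma,\sigma,s)\big]+n\ \ge\ -(n-d)+n\ =\ d .$$ 2. For all $0\le d\le n$ (including $d=n$) and every $\delta>0$ there is $\sigma_0>0$, depending only on the law of $\mathbf x$ and on $\delta$, such that for all $0<\sigma<\sigma_0$ and all $s$ admissible at noise level $\sigma$, $$\mathbb E\big[\mathrm{FLIPD}(\tilde{\mathbf x}_\sigma,\sigma,s)\big]\ \ge\ \mathbb E\big[\mathcal L_{\mathrm{ISM}}(\tilde{\mathbf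 x}_\sigma,\sigma,s)\big]+n\ \ge\ -(n-d)+n-\delta\ =\ d-\delta .$$ -/

import Mathlib

open MeasureTheory ProbabilityTheory
open scoped NNReal ENNReal

namespace ScoreMatching

/-- Ambient Euclidean space `ℝⁿ` with the Euclidean norm. -/
abbrev Space (n : ℕ) : Type := EuclideanSpace ℝ (Fin n)

/-- `M` is a `d`-dimensional embedded submanifold (without boundary) of `ℝⁿ`: around each of its
points there is a slice chart, that is, a diffeomorphism `Φ` between open subsets of `ℝⁿ` which
straightens `M` to a `d`-dimensional linear subspace `L`. Only class `C¹` is required, so smooth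
submanifolds are included. Neither compactness, closedness nor connectedness is required. -/
def IsEmbeddedSubmanifold {n : ℕ} (d : ℕ) (M : Set (Space n)) : Prop :=
  ∀ x ∈ M, ∃ (Φ : OpenPartialHomeomorph (Space n) (Space n)) (L : Submodule ℝ (Space n)),
    x ∈ Φ.source ∧
    ContDiffOn ℝ 1 Φ Φ.source ∧
    ContDiffOn ℝ 1 Φ.symm Φ.target ∧
    Module.finrank ℝ L = d ∧
    ∀ y ∈ Φ.source, (y ∈ M ↔ Φ y ∈ L)

/-- The data distribution: the measure carried by `M` with density `p` with respect to the
`d`-dimensional volume on `M`, i.e. the `d`-dimensional Hausdorff measure restricted to `M`. -/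
noncomputable def dataLaw {n : ℕ} (d : ℕ) (M : Set (Space n)) (p : Space n → ℝ≥0) :
    Measure (Space n) :=
  ((μH[(d : ℝ)] : Measure (Space n)).restrict M).withDensity (fun x => (p x : ℝ≥0∞))

/-- The noised distribution `μ * N(0, σ² I)`, the law of `x + σ ε` with `x ∼ μ` and an independent
standard Gaussian vector `ε`. -/
noncomputable def noised {n : ℕ} (μ : Measure (Space n)) (σ : ℝ) : Measure (Space n) :=
  μ.conv ((stdGaussian (Space n)).map (fun ε => σ • ε))

/-- The divergence `∇ · s = ∑ᵢ ∂ᵢ sᵢ` of a vector field. -/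
noncomputable def divergence {n : ℕ} (s : Space n → Space n) (x : Space n) : ℝ :=
  ∑ i : Fin n, (fderiv ℝ s x (EuclideanSpace.single i 1)) i

/-- The pointwise (scaled) implicit score matching loss of the score function `s`. -/
noncomputable def ismLoss {n : ℕ} (s : Space n → Space n) (σ : ℝ) (x : Space n) : ℝ :=
  σ ^ 2 * (divergence s x + 1 / 2 * ‖s x‖ ^ 2)

/-- `FLIPD` of the score function `s` at the point `x` and noise level `σ`. -/
noncomputable def flipd {n : ℕ} (s : Space n → Space n) (σ : ℝ) (x : Space n) : ℝ :=
  ismLoss s σ x + σ ^ 2 / 2 * ‖s x‖ ^ 2 + n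

end ScoreMatching

/-!
The implicit score matching loss is a denoising error in disguise. Write the noised point as
`y = x + σ ε` with `ε` standard Gaussian. For a fixed base point `x`, Stein's identity
(`integral_divergence_stdGaussian`) gives `E[σ² ∇ · s (y)] = σ E⟨ε, s (y)⟩`, and completing the
square yields `2 E[L_ISM] + n = E ‖ε + σ s (y)‖²`. This is the mean square error of `-σ s (y)` as an
estimator of the noise `ε`. Hence the loss is bounded below by `(m - n) / 2` as soon as every
estimator has error at least `m`, and the claim is that `m` may be taken arbitrarily close to `d`
for small `σ` (`eventually_le_denoisingCost_dataLaw`). The resulting bound `-(n - d) / 2 - δ` is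
stronger than `-(n - d) - δ`, and it is what allows `δ = 0` when `d < n`.

The lower bound on the error comes from pairing different explanations of the same observation. If
the data were uniform on a subspace `L`, then `(u, ε)` and `(u + 2 σ π ε, ε - 2 π ε)`, with `π` the
projection to `L`, would be equally likely and lead to the same `y`, and by the parallelogram law
the errors at the two points add up to at least `2 ‖π ε‖²`, whatever the estimator. Since
`E ‖π ε‖² = d`, the error would be at least `d`.

A `C¹` submanifold is locally the image of an open subset of a subspace `L` under `u ↦ u + g u`
with `g` Lipschitz with an arbitrarily small constant `κ`
(`IsEmbeddedSubmanifold.exists_tilt_image_eq`). The reflection still makes sense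
(`reflectNoise`). By the Hausdorff measure estimate for expanding maps it distorts the product of
Haar and Lebesgue measure by a factor that tends to `1` as `κ → 0`
(`lintegral_comp_reflectNoise_le`), and it changes the Gaussian density by a controlled amount.
The density on the parameter domain is lower semicontinuous, so its values at `u` and at
`u + 2 σ π ε` agree in the limit `σ → 0`; dominated convergence concludes
(`lintegral_min_le_denoisingCost`, `tendsto_lintegral_min`). No area formula is needed: the
parametrisation is bi-Lipschitz with constants `1 ± κ`, so the Hausdorff measure of the submanifold
is comparable to that of `L` with constants tending to `1`.

The error is additive and monotone in the data law, so the local bounds can be summed over finitely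
many disjoint open sets that carry almost all of the mass (`exists_disjoint_isOpen_lt_sum`).
-/

namespace ScoreMatching

open Module Filter Topology

/-! ### The standard Gaussian measure -/

section Gaussian

variable {E : Type*} [NormedAddCommGroup E] [InnerProductSpace ℝ E]

/-- The density of the standard Gaussian measure with respect to Lebesgue measure. -/
noncomputable def gaussianDensity (x : E) : ℝ :=
  (2 * Real.pi) ^ (-(finrank ℝ E : ℝ) / 2) * Real.exp (-‖x‖ ^ 2 / 2)

lemma gaussianDensity_pos (x : E) : 0 < gaussianDensity x := by
  unfold gaussianDensity; positivity

@[fun_prop]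
lemma measurable_gaussianDensity [MeasurableSpace E] [BorelSpace E] :
    Measurable (gaussianDensity (E := E)) := by
  unfold gaussianDensity; fun_prop

lemma gaussianDensity_le_of_norm_le {x y : E} (h : ‖x‖ ≤ ‖y‖) :
    gaussianDensity y ≤ gaussianDensity x := by
  unfold gaussianDensity
  gcongr

variable [FiniteDimensional ℝ E] [MeasurableSpace E] [BorelSpace E]

lemma integral_exp_neg_sq_norm_half :
    ∫ x : E, Real.exp (-‖x‖ ^ 2 / 2) = (2 * Real.pi) ^ ((finrank ℝ E : ℝ) / 2) := by
  have h := GaussianFourier.integral_rexp_neg_mul_sq_norm (V := E) (b := 1 / 2) (by norm_num)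
  have e : Real.pi / (1 / 2) = 2 * Real.pi := by ring
  rw [e] at h
  rw [← h]
  congr 1; ext x; congr 1; ring

lemma integral_gaussianDensity : ∫ x : E, gaussianDensity x = 1 := by
  unfold gaussianDensity
  rw [integral_const_mul, integral_exp_neg_sq_norm_half, ← Real.rpow_add (by positivity)]
  simp [neg_div]

lemma integrable_gaussianDensity : Integrable (gaussianDensity (E := E)) :=
  .of_integral_ne_zero (by simp [integral_gaussianDensity])

/-- The two measures have the same characteristic function. -/
lemma stdGaussian_eq_withDensity :
    stdGaussian E = volume.withDensity (fun x : E => ENNReal.ofReal (gaussianDensity x)) := by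
  have hfin : IsFiniteMeasure
      (volume.withDensity (fun x : E => ENNReal.ofReal (gaussianDensity x))) :=
    isFiniteMeasure_withDensity_ofReal integrable_gaussianDensity.2
  refine Measure.ext_of_charFun ?_
  ext t
  rw [charFun_stdGaussian, charFun_apply,
    integral_withDensity_eq_integral_toReal_smul
      (measurable_gaussianDensity.ennreal_ofReal) (by simp)]
  have h := GaussianFourier.integral_cexp_neg_mul_sq_norm_add (V := E) (b := 1 / 2)
    (by norm_num) Complex.I t
  have e : (Real.pi : ℂ) / (1 / 2) = ((2 * Real.pi : ℝ) : ℂ) := by push_cast; ring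
  rw [e] at h
  have h2 : ∀ v : E, (ENNReal.ofReal (gaussianDensity v)).toReal •
      Complex.exp (((inner ℝ v t : ℝ) : ℂ) * Complex.I) =
      (((2 * Real.pi) ^ (-(finrank ℝ E : ℝ) / 2) : ℝ) : ℂ) *
        Complex.exp (-(1 / 2) * (‖v‖ : ℂ) ^ 2 + Complex.I * (inner ℝ t v : ℝ)) := by
    intro v
    rw [ENNReal.toReal_ofReal (gaussianDensity_pos v).le, gaussianDensity, Complex.real_smul,
      Complex.exp_add, real_inner_comm]
    push_cast
    rw [mul_assoc]
    congr 3
    · ring_nf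
    · ring_nf
  simp_rw [h2]
  rw [integral_const_mul, h, ← mul_assoc]
  have h3 : (((2 * Real.pi) ^ (-(finrank ℝ E : ℝ) / 2) : ℝ) : ℂ) *
      (((2 * Real.pi : ℝ) : ℂ) ^ ((finrank ℝ E : ℂ) / 2)) = 1 := by
    have : ((finrank ℝ E : ℂ) / 2) = (((finrank ℝ E : ℝ) / 2 : ℝ) : ℂ) := by push_cast; rfl
    rw [this, ← Complex.ofReal_cpow (by positivity), ← Complex.ofReal_mul,
      ← Real.rpow_add (by positivity)]
    simp [neg_div]
  rw [h3, one_mul]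
  congr 1
  rw [Complex.I_sq]; ring

lemma lintegral_stdGaussian {f : E → ℝ≥0∞} (hf : Measurable f) :
    ∫⁻ x, f x ∂(stdGaussian E) = ∫⁻ x, ENNReal.ofReal (gaussianDensity x) * f x := by
  rw [stdGaussian_eq_withDensity,
    lintegral_withDensity_eq_lintegral_mul _ measurable_gaussianDensity.ennreal_ofReal hf]
  rfl

lemma integrable_sq_inner_stdGaussian (v : E) :
    Integrable (fun x => (inner ℝ v x : ℝ) ^ 2) (stdGaussian E) :=
  ((IsGaussian.memLp_dual (stdGaussian E) (innerSL ℝ v) 2 (by simp)).integrable_sq)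

lemma integral_sq_inner_stdGaussian (v : E) :
    ∫ x, (inner ℝ v x : ℝ) ^ 2 ∂(stdGaussian E) = ‖v‖ ^ 2 := by
  have h := variance_dual_stdGaussian (innerSL ℝ v)
  rw [variance_of_integral_eq_zero (by fun_prop) (integral_strongDual_stdGaussian _)] at h
  simpa using h

lemma integrable_sq_norm_orthogonalProjectionOnto_stdGaussian (L : Submodule ℝ E) :
    Integrable (fun x => ‖L.orthogonalProjectionOnto x‖ ^ 2) (stdGaussian E) ∧
    ∫ x, ‖L.orthogonalProjectionOnto x‖ ^ 2 ∂(stdGaussian E) = finrank ℝ L := by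
  set b := stdOrthonormalBasis ℝ L
  have h : ∀ x, ‖L.orthogonalProjectionOnto x‖ ^ 2 = ∑ i, (inner ℝ (b i : E) x : ℝ) ^ 2 := by
    intro x
    rw [← b.sum_sq_inner_right]
    refine Finset.sum_congr rfl fun i _ => ?_
    simp
  simp_rw [h]
  refine ⟨integrable_finsetSum _ fun i _ => integrable_sq_inner_stdGaussian _, ?_⟩
  rw [integral_finsetSum _ fun i _ => integrable_sq_inner_stdGaussian _]
  have hb : ∀ i, ‖(b i : E)‖ = 1 := fun i => b.norm_eq_one i
  simp [integral_sq_inner_stdGaussian, hb]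

lemma lintegral_sq_norm_orthogonalProjectionOnto_stdGaussian (L : Submodule ℝ E) :
    ∫⁻ x, ‖L.orthogonalProjectionOnto x‖ₑ ^ 2 ∂(stdGaussian E) = finrank ℝ L := by
  obtain ⟨h1, h2⟩ := integrable_sq_norm_orthogonalProjectionOnto_stdGaussian L
  have := ofReal_integral_eq_lintegral_ofReal h1 (.of_forall fun _ => by positivity)
  rw [h2] at this
  simp only [ENNReal.ofReal_pow (norm_nonneg _), ofReal_norm] at this
  rw [← this]; simp

end Gaussian

/-! ### Reflecting the noise at a tilted subspace -/

section Reflection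

variable {E : Type*} [NormedAddCommGroup E] [InnerProductSpace ℝ E]
  {L : Submodule ℝ E} {g : L → E} {κ : ℝ≥0}

/-- The parametrised surface `u ↦ u + g u` over the subspace `L`. -/
def tilt {L : Submodule ℝ E} (g : L → E) (u : L) : E := (u : E) + g u

lemma continuous_tilt (hg : LipschitzWith κ g) : Continuous (tilt g) :=
  continuous_subtype_val.add hg.continuous

lemma le_norm_tilt_sub (hg : LipschitzWith κ g) (u v : L) :
    (1 - κ) * ‖u - v‖ ≤ ‖tilt g u - tilt g v‖ := by
  have h1 : tilt g u - tilt g v = ((u - v : L) : E) - (g v - g u) := by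
    simp [tilt]; abel
  have h2 := hg.norm_sub_le v u
  have h3 := norm_sub_norm_le ((u - v : L) : E) (g v - g u)
  rw [norm_sub_rev v u] at h2
  rw [h1]
  rw [Submodule.coe_norm] at *
  linarith

variable [FiniteDimensional ℝ E]

/-- The reflection of a decomposition `y = tilt g u + σ ε` of a noised point, as a map of pairs
`(u, ε)`: the base point `u` moves
by twice the component of `σ ε` along `L`, and the noise is adjusted so that `y` is unchanged. -/
noncomputable def reflectNoise (g : L → E) (σ : ℝ) (z : L × E) : L × E :=
  (z.1 + (2 * σ) • L.orthogonalProjectionOnto z.2,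
    z.2 + σ⁻¹ • (tilt g z.1 - tilt g (z.1 + (2 * σ) • L.orthogonalProjectionOnto z.2)))

lemma continuous_reflectNoise (hg : LipschitzWith κ g) (σ : ℝ) :
    Continuous (reflectNoise g σ) := by
  have := continuous_tilt hg
  unfold reflectNoise
  fun_prop

lemma reflectNoise_noised {σ : ℝ} (hσ : σ ≠ 0) (z : L × E) :
    tilt g (reflectNoise g σ z).1 + σ • (reflectNoise g σ z).2 = tilt g z.1 + σ • z.2 := by
  simp only [reflectNoise, smul_add, smul_smul, mul_inv_cancel₀ hσ, one_smul]
  abel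

lemma norm_sub_two_smul_orthogonalProjectionOnto (x : E) :
    ‖x - (2 : ℝ) • (L.orthogonalProjectionOnto x : E)‖ = ‖x‖ := by
  have h := L.reflection.norm_map x
  rw [Submodule.reflection_apply, ← norm_neg] at h
  rw [← h, Submodule.starProjection_apply]
  congr 1
  rw [two_smul, two_smul]; abel

/-- With the endpoint fixed, the new noise is an expanding function of the old one up to a factor
`1 - 2κ`, because it is a small Lipschitz perturbation of an orthogonal reflection. -/
lemma antilipschitz_reflected_noise (hg : LipschitzWith κ g) (hκ : 2 * κ < 1) {σ : ℝ} (hσ : 0 < σ)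
    (u : L) : AntilipschitzWith (1 - 2 * κ)⁻¹
      (fun ε : E =>
        ε + σ⁻¹ • (tilt g (u - (2 * σ) • L.orthogonalProjectionOnto ε) - tilt g u)) := by
  refine AntilipschitzWith.of_le_mul_dist fun x y => ?_
  have hκ' : (2 * κ : ℝ) < 1 := by exact_mod_cast hκ
  rw [NNReal.coe_inv, NNReal.coe_sub hκ.le]
  push_cast
  rw [← div_eq_inv_mul, le_div_iff₀ (by linarith), dist_eq_norm, dist_eq_norm]
  set P := L.orthogonalProjectionOnto
  have key : x + σ⁻¹ • (tilt g (u - (2 * σ) • P x) - tilt g u) -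
      (y + σ⁻¹ • (tilt g (u - (2 * σ) • P y) - tilt g u)) =
      ((x - y) - (2 : ℝ) • (P (x - y) : E)) -
        σ⁻¹ • (g (u - (2 * σ) • P y) - g (u - (2 * σ) • P x)) := by
    have : σ⁻¹ * (2 * σ) = 2 := by field_simp
    simp only [tilt, smul_add, smul_sub, Submodule.coe_sub, Submodule.coe_smul, map_sub, smul_smul,
      this]
    abel
  rw [key]
  have h1 := norm_sub_norm_le ((x - y) - (2 : ℝ) • (P (x - y) : E))
    (σ⁻¹ • (g (u - (2 * σ) • P y) - g (u - (2 * σ) • P x)))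
  rw [norm_sub_two_smul_orthogonalProjectionOnto] at h1
  have h2 := hg.norm_sub_le (u - (2 * σ) • P y) (u - (2 * σ) • P x)
  have h3 : (u - (2 * σ) • P y) - (u - (2 * σ) • P x) = (2 * σ) • P (x - y) := by
    rw [map_sub, smul_sub]; abel
  rw [h3, norm_smul, Real.norm_of_nonneg (by positivity)] at h2
  have h4 : ‖P (x - y)‖ ≤ ‖x - y‖ := L.norm_orthogonalProjectionOnto_apply_le _
  have h5 : ‖σ⁻¹ • (g (u - (2 * σ) • P y) - g (u - (2 * σ) • P x))‖ ≤ 2 * κ * ‖x - y‖ := by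
    rw [norm_smul, Real.norm_of_nonneg (by positivity), inv_mul_le_iff₀ hσ]
    calc _ ≤ κ * (2 * σ * ‖P (x - y)‖) := h2
      _ ≤ κ * (2 * σ * ‖x - y‖) := by gcongr
      _ = _ := by ring
  linarith

lemma norm_reflectNoise_snd_le (hg : LipschitzWith κ g) {σ : ℝ} (hσ : 0 < σ) (z : L × E) :
    ‖(reflectNoise g σ z).2‖ ≤ ‖(1 + 2 * (κ : ℝ)) • z.2‖ := by
  obtain ⟨u, ε⟩ := z
  set P := L.orthogonalProjectionOnto with hP
  have key : (reflectNoise g σ (u, ε)).2 =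
      (ε - (2 : ℝ) • (P ε : E)) + σ⁻¹ • (g u - g (u + (2 * σ) • P ε)) := by
    have : σ⁻¹ * (2 * σ) = 2 := by field_simp
    simp only [reflectNoise, tilt, smul_add, smul_sub, Submodule.coe_add, Submodule.coe_smul,
      smul_smul, this, ← hP]
    abel
  have h2 := hg.norm_sub_le u (u + (2 * σ) • P ε)
  rw [show u - (u + (2 * σ) • P ε) = -((2 * σ) • P ε) by abel, norm_neg, norm_smul,
    Real.norm_of_nonneg (by positivity)] at h2
  have h4 : ‖P ε‖ ≤ ‖ε‖ := L.norm_orthogonalProjectionOnto_apply_le _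
  have h5 : ‖σ⁻¹ • (g u - g (u + (2 * σ) • P ε))‖ ≤ 2 * κ * ‖ε‖ := by
    rw [norm_smul, Real.norm_of_nonneg (by positivity), inv_mul_le_iff₀ hσ]
    calc _ ≤ κ * (2 * σ * ‖P ε‖) := h2
      _ ≤ κ * (2 * σ * ‖ε‖) := by gcongr
      _ = _ := by ring
  rw [key, norm_smul, Real.norm_of_nonneg (by positivity)]
  refine (norm_add_le _ _).trans ?_
  rw [norm_sub_two_smul_orthogonalProjectionOnto]
  linarith

/-- The two noise vectors related by the reflection cannot both be close to the same
estimate, since they differ by about twice the tangential component. -/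
lemma sq_norm_add_sq_norm_reflectNoise (hg : LipschitzWith κ g) (hκ : κ < 1) {σ : ℝ} (hσ : 0 < σ)
    (z : L × E) (c : E) :
    2 * ((1 - κ) ^ 2 * ‖L.orthogonalProjectionOnto z.2‖ ^ 2) ≤
      ‖z.2 + c‖ ^ 2 + ‖(reflectNoise g σ z).2 + c‖ ^ 2 := by
  set P := L.orthogonalProjectionOnto with hP
  have hκ' : (κ : ℝ) < 1 := by exact_mod_cast hκ
  have h1 := le_norm_tilt_sub hg (z.1 + (2 * σ) • P z.2) z.1
  rw [add_sub_cancel_left, norm_smul, Real.norm_of_nonneg (by positivity)] at h1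
  have h2 : (z.2 + c) - ((reflectNoise g σ z).2 + c) =
      σ⁻¹ • (tilt g (z.1 + (2 * σ) • P z.2) - tilt g z.1) := by
    simp only [reflectNoise, smul_sub, ← hP]
    abel
  have h3 : 2 * ((1 - κ) * ‖P z.2‖) ≤ ‖(z.2 + c) - ((reflectNoise g σ z).2 + c)‖ := by
    rw [h2, norm_smul, Real.norm_of_nonneg (by positivity), le_inv_mul_iff₀ hσ]
    linarith
  have h4 := parallelogram_law_with_norm ℝ (z.2 + c) ((reflectNoise g σ z).2 + c)
  have h5 : 0 ≤ (1 - κ) * ‖P z.2‖ := mul_nonneg (by linarith) (norm_nonneg _)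
  nlinarith [sq_nonneg ‖(z.2 + c) + ((reflectNoise g σ z).2 + c)‖]

variable [MeasurableSpace E] [BorelSpace E]

/-- Haar measure is a multiple of Hausdorff measure, for which expanding maps have small
preimages. -/
lemma map_le_smul_of_antilipschitz (μ : Measure E) [μ.IsAddHaarMeasure] {S : E → E} {K : ℝ≥0}
    (hS : AntilipschitzWith K S) (hm : Measurable S) :
    μ.map S ≤ (K : ℝ≥0∞) ^ finrank ℝ E • μ := by
  refine Measure.le_iff.2 fun A hA => ?_
  rw [Measure.map_apply hm hA, Measure.smul_apply, smul_eq_mul]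
  have h := hS.hausdorffMeasure_preimage_le (d := finrank ℝ E) (by positivity) A
  rw [ENNReal.rpow_natCast] at h
  rw [Measure.isAddLeftInvariant_eq_smul μ (μH[(finrank ℝ E : ℝ)] : Measure E)]
  simp only [Measure.smul_apply, ENNReal.smul_def, smul_eq_mul]
  rw [mul_left_comm]
  gcongr

variable (α : Measure L) [α.IsAddHaarMeasure]

/-- The reflection distorts the product of the Haar measure on `L` and Lebesgue measure by a
factor that tends to `1` with the Lipschitz constant of `g`. -/
lemma lintegral_comp_reflectNoise_le (hg : LipschitzWith κ g) (hκ : 2 * κ < 1) {σ : ℝ}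
    (hσ : 0 < σ) {f : L × E → ℝ≥0∞} (hf : Measurable f) :
    ∫⁻ z, f (reflectNoise g σ z) ∂(α.prod volume) ≤
      (((1 - 2 * κ)⁻¹ : ℝ≥0) : ℝ≥0∞) ^ finrank ℝ E * ∫⁻ z, f z ∂(α.prod volume) := by
  have hc := continuous_tilt hg
  set P := L.orthogonalProjectionOnto
  let S : L → E → E := fun u ε => ε + σ⁻¹ • (tilt g (u - (2 * σ) • P ε) - tilt g u)
  have hS : Continuous (fun z : L × E => S z.1 z.2) := by fun_prop
  have hfS : Measurable (fun z : L × E => f (z.1, S z.1 z.2)) :=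
    hf.comp (measurable_fst.prodMk hS.measurable)
  calc ∫⁻ z, f (reflectNoise g σ z) ∂(α.prod volume)
      = ∫⁻ ε, ∫⁻ u, f (reflectNoise g σ (u, ε)) ∂α :=
        lintegral_prod_symm' _ (hf.comp (continuous_reflectNoise hg σ).measurable)
    -- translating `u` by `2 σ π ε` makes the new base point the integration variable
    _ = ∫⁻ ε, ∫⁻ u, f (u, S u ε) ∂α := by
        refine lintegral_congr fun ε => ?_
        rw [← lintegral_add_right_eq_self (fun u => f (u, S u ε)) ((2 * σ) • P ε)]
        simp [reflectNoise, S, P]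
    _ = ∫⁻ u, ∫⁻ ε, f (u, S u ε) ∂volume ∂α := by
        rw [← lintegral_prod_symm' _ hfS, lintegral_prod _ hfS.aemeasurable]
    _ ≤ ∫⁻ u, (((1 - 2 * κ)⁻¹ : ℝ≥0) : ℝ≥0∞) ^ finrank ℝ E * ∫⁻ ε, f (u, ε) ∂volume ∂α := by
        refine lintegral_mono fun u => ?_
        have hSu : Measurable (S u) :=
          (hS.comp (by fun_prop : Continuous (fun ε => (u, ε)))).measurable
        have hfu : Measurable (fun ε => f (u, ε)) := hf.comp measurable_prodMk_left
        have h := lintegral_mono' (map_le_smul_of_antilipschitz volume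
          (antilipschitz_reflected_noise hg hκ hσ u) hSu) (le_refl (fun ε => f (u, ε)))
        rw [lintegral_map hfu hSu, lintegral_smul_measure] at h
        exact h
    _ = _ := by
        rw [lintegral_const_mul _ hf.lintegral_prod_right', lintegral_prod _ hf.aemeasurable]

end Reflection

/-! ### The denoising cost of a tilted piece -/

section DenoisingCost

variable {E : Type*} [NormedAddCommGroup E] [InnerProductSpace ℝ E]
  [FiniteDimensional ℝ E] [MeasurableSpace E]

/-- The mean square error `∫∫ ‖ε + h (x + σ ε)‖² dγ(ε) dμ(x)` of `-h` as an estimator of the noise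
`ε` given the noised sample `x + σ ε`, where `x` has law `μ` and `γ` is the standard Gaussian. -/
noncomputable def denoisingCost (μ : Measure E) (σ : ℝ) (h : E → E) : ℝ≥0∞ :=
  ∫⁻ x, ∫⁻ ε, ‖ε + h (x + σ • ε)‖ₑ ^ 2 ∂(stdGaussian E) ∂μ

lemma denoisingCost_mono {μ ν : Measure E} (hμν : μ ≤ ν) (σ : ℝ) (h : E → E) :
    denoisingCost μ σ h ≤ denoisingCost ν σ h :=
  lintegral_mono' hμν le_rfl

variable [BorelSpace E] {L : Submodule ℝ E} {g : L → E} {κ : ℝ≥0}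

/-- The comparison density `ρ((1 + 2κ) ε)`, which is below the Gaussian density at both noise
vectors related by the reflection, times the squared tangential component of the noise. -/
noncomputable def tangentialWeight (L : Submodule ℝ E) (κ : ℝ≥0) (ε : E) : ℝ≥0∞ :=
  ENNReal.ofReal (gaussianDensity ((1 + 2 * (κ : ℝ)) • ε)) * ‖L.orthogonalProjectionOnto ε‖ₑ ^ 2

lemma measurable_tangentialWeight : Measurable (tangentialWeight L κ) := by
  unfold tangentialWeight
  fun_prop

lemma lintegral_tangentialWeight :
    ∫⁻ ε, tangentialWeight L κ ε =
      ENNReal.ofReal ((1 + 2 * (κ : ℝ))⁻¹ ^ (finrank ℝ E + 2)) * finrank ℝ L := by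
  set a : ℝ := 1 + 2 * (κ : ℝ) with ha
  have ha0 : 0 < a := by positivity
  rw [← lintegral_sq_norm_orthogonalProjectionOnto_stdGaussian, lintegral_stdGaussian (by fun_prop)]
  have h1 : ∀ ε : E, tangentialWeight L κ ε = ENNReal.ofReal (a⁻¹ ^ 2) *
      (fun x : E => ENNReal.ofReal (gaussianDensity x) * ‖L.orthogonalProjectionOnto x‖ₑ ^ 2)
        (a • ε) := by
    intro ε
    simp only [tangentialWeight, ← ha, map_smul, enorm_smul, mul_pow]
    rw [show ‖a‖ₑ ^ 2 = ENNReal.ofReal (a ^ 2) by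
      rw [ENNReal.ofReal_pow ha0.le, Real.enorm_of_nonneg ha0.le],
      mul_left_comm (ENNReal.ofReal (a⁻¹ ^ 2)), ← mul_assoc (ENNReal.ofReal (a⁻¹ ^ 2)),
      ← ENNReal.ofReal_mul (by positivity)]
    rw [show a⁻¹ ^ 2 * a ^ 2 = 1 by field_simp]
    simp
  simp_rw [h1]
  rw [lintegral_const_mul _ (by fun_prop)]
  have h2 := lintegral_map (μ := (volume : Measure E)) (g := fun x : E => a • x)
    (f := fun x : E => ENNReal.ofReal (gaussianDensity x) * ‖L.orthogonalProjectionOnto x‖ₑ ^ 2)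
    (by fun_prop) (by fun_prop)
  rw [← h2, Measure.map_addHaar_smul _ ha0.ne', lintegral_smul_measure, smul_eq_mul, ← mul_assoc,
    ← ENNReal.ofReal_mul (by positivity), abs_of_pos (by positivity), ← inv_pow, ← pow_add,
    add_comm 2]

variable (α : Measure L)

lemma denoisingCost_map_tilt [SFinite α] (hg : LipschitzWith κ g) {w : L → ℝ≥0∞}
    (hw : Measurable w)
    {h : E → E} (hh : Measurable h) (σ : ℝ) :
    denoisingCost ((α.withDensity w).map (tilt g)) σ h =
      ∫⁻ z, w z.1 * ENNReal.ofReal (gaussianDensity z.2) * ‖z.2 + h (tilt g z.1 + σ • z.2)‖ₑ ^ 2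
        ∂(α.prod volume) := by
  have hc := (continuous_tilt hg).measurable
  have hm : Measurable fun x => ∫⁻ ε, ‖ε + h (x + σ • ε)‖ₑ ^ 2 ∂(stdGaussian E) := by
    refine Measurable.lintegral_prod_right'
      (f := fun z : E × E => ‖z.2 + h (z.1 + σ • z.2)‖ₑ ^ 2) ?_
    fun_prop
  unfold denoisingCost
  rw [lintegral_map hm hc]
  refine (lintegral_withDensity_eq_lintegral_mul _ hw (hm.comp hc)).trans ?_
  rw [lintegral_prod _ (by fun_prop)]
  refine lintegral_congr fun u => ?_
  rw [Pi.mul_apply, Function.comp_apply, lintegral_stdGaussian (by fun_prop),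
    ← lintegral_const_mul _ (by fun_prop)]
  simp only [mul_assoc]

/-- The pairing bound: averaging the cost over the two points related by the reflection bounds it
from below by a quantity that does not involve the estimator. -/
lemma lintegral_min_le_denoisingCost [α.IsAddHaarMeasure] (hg : LipschitzWith κ g)
    (hκ : 2 * κ < 1) {w : L → ℝ≥0∞}
    (hw : Measurable w) {h : E → E} (hh : Measurable h) {σ : ℝ} (hσ : 0 < σ) :
    ENNReal.ofReal ((1 - κ) ^ 2) *
      ∫⁻ z, min (w z.1) (w (z.1 + (2 * σ) • L.orthogonalProjectionOnto z.2)) *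
        tangentialWeight L κ z.2 ∂(α.prod volume) ≤
    (((1 - 2 * κ)⁻¹ : ℝ≥0) : ℝ≥0∞) ^ finrank ℝ E *
      denoisingCost ((α.withDensity w).map (tilt g)) σ h := by
  set C : ℝ≥0∞ := (((1 - 2 * κ)⁻¹ : ℝ≥0) : ℝ≥0∞) ^ finrank ℝ E with hC
  set I := denoisingCost ((α.withDensity w).map (tilt g)) σ h with hI
  have hκ1 : κ < 1 := lt_of_le_of_lt (by rw [two_mul]; exact le_add_self) hκ
  have hC1 : 1 ≤ C := by
    refine one_le_pow₀ ?_
    rw [ENNReal.one_le_coe_iff]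
    exact (one_le_inv₀ (tsub_pos_of_lt hκ)).2 tsub_le_self
  have hc := (continuous_tilt hg).measurable
  set Φ : L × E → ℝ≥0∞ := fun z =>
    w z.1 * ENNReal.ofReal (gaussianDensity z.2) * ‖z.2 + h (tilt g z.1 + σ • z.2)‖ₑ ^ 2 with hΦ
  have hΦm : Measurable Φ := by rw [hΦ]; fun_prop
  have hT := (continuous_reflectNoise hg σ).measurable
  have hIΦ : I = ∫⁻ z, Φ z ∂(α.prod volume) := denoisingCost_map_tilt α hg hw hh σ
  -- both densities dominate their common minorant, and the two errors share the estimate `c`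
  have hptw : ∀ z : L × E, 2 * (ENNReal.ofReal ((1 - κ) ^ 2) *
      (min (w z.1) (w (z.1 + (2 * σ) • L.orthogonalProjectionOnto z.2)) *
        tangentialWeight L κ z.2)) ≤ Φ z + Φ (reflectNoise g σ z) := by
    intro z
    set c := h (tilt g z.1 + σ • z.2) with hcdef
    have h1 : 2 * (ENNReal.ofReal ((1 - κ) ^ 2) * ‖L.orthogonalProjectionOnto z.2‖ₑ ^ 2) ≤
        ‖z.2 + c‖ₑ ^ 2 + ‖(reflectNoise g σ z).2 + c‖ₑ ^ 2 := by
      have := ENNReal.ofReal_le_ofReal (sq_norm_add_sq_norm_reflectNoise hg hκ1 hσ z c)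
      rw [ENNReal.ofReal_add (by positivity) (by positivity),
        ENNReal.ofReal_mul (by norm_num), ENNReal.ofReal_mul (by positivity)] at this
      simpa only [ENNReal.ofReal_pow (norm_nonneg _), ofReal_norm, ENNReal.ofReal_ofNat] using this
    have hb1 : ENNReal.ofReal (gaussianDensity ((1 + 2 * (κ : ℝ)) • z.2)) ≤
        ENNReal.ofReal (gaussianDensity z.2) := by
      refine ENNReal.ofReal_le_ofReal (gaussianDensity_le_of_norm_le ?_)
      rw [norm_smul, Real.norm_of_nonneg (by positivity)]
      exact le_mul_of_one_le_left (norm_nonneg _) (by simp)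
    have hb2 : ENNReal.ofReal (gaussianDensity ((1 + 2 * (κ : ℝ)) • z.2)) ≤
        ENNReal.ofReal (gaussianDensity (reflectNoise g σ z).2) :=
      ENNReal.ofReal_le_ofReal (gaussianDensity_le_of_norm_le (norm_reflectNoise_snd_le hg hσ z))
    set m := min (w z.1) (w (z.1 + (2 * σ) • L.orthogonalProjectionOnto z.2)) *
      ENNReal.ofReal (gaussianDensity ((1 + 2 * (κ : ℝ)) • z.2)) with hm
    calc _ = m * (2 * (ENNReal.ofReal ((1 - κ) ^ 2) * ‖L.orthogonalProjectionOnto z.2‖ₑ ^ 2)) := by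
          rw [hm, tangentialWeight]; ring
      _ ≤ m * (‖z.2 + c‖ₑ ^ 2 + ‖(reflectNoise g σ z).2 + c‖ₑ ^ 2) := by gcongr
      _ ≤ Φ z + Φ (reflectNoise g σ z) := by
          rw [mul_add, hΦ]
          simp only [reflectNoise_noised hσ.ne', ← hcdef]
          gcongr
          · exact mul_le_mul' (min_le_left _ _) hb1
          · exact mul_le_mul' (min_le_right _ _) hb2
  -- integrate the pointwise bound; the distortion constant `C ≥ 1` covers both terms
  have h2 : 2 * (ENNReal.ofReal ((1 - κ) ^ 2) *
      ∫⁻ z, min (w z.1) (w (z.1 + (2 * σ) • L.orthogonalProjectionOnto z.2)) *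
        tangentialWeight L κ z.2 ∂(α.prod volume)) ≤ 2 * (C * I) := by
    rw [← lintegral_const_mul' _ _ ENNReal.ofReal_ne_top, ← lintegral_const_mul' _ _ (by simp)]
    calc _ ≤ ∫⁻ z, Φ z + Φ (reflectNoise g σ z) ∂(α.prod volume) := lintegral_mono hptw
      _ = I + ∫⁻ z, Φ (reflectNoise g σ z) ∂(α.prod volume) := by
        rw [lintegral_add_left hΦm, hIΦ]
      _ ≤ C * I + C * I := by
        refine add_le_add (le_mul_of_one_le_left zero_le hC1) ?_
        rw [hIΦ]
        exact lintegral_comp_reflectNoise_le α hg hκ hσ hΦm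
      _ = _ := by ring
  exact (ENNReal.mul_le_mul_iff_right (by simp) (by simp)).1 h2

/-- As the noise level tends to zero, the estimator-free lower bound of the pairing argument tends
to its value for an infinite flat piece. -/
lemma tendsto_lintegral_min [SFinite α] {w : L → ℝ≥0∞} (hw : LowerSemicontinuous w)
    (hfin : ∫⁻ u, w u ∂α ≠ ∞) :
    Tendsto (fun σ : ℝ => ∫⁻ z, min (w z.1) (w (z.1 + (2 * σ) • L.orthogonalProjectionOnto z.2)) *
        tangentialWeight L κ z.2 ∂(α.prod volume)) (𝓝[>] 0)
      (𝓝 ((∫⁻ u, w u ∂α) *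
        (ENNReal.ofReal ((1 + 2 * (κ : ℝ))⁻¹ ^ (finrank ℝ E + 2)) * finrank ℝ L))) := by
  have hwm := hw.measurable
  have htw : Measurable (tangentialWeight L κ) := measurable_tangentialWeight
  have hlim : ∫⁻ z, w z.1 * tangentialWeight L κ z.2 ∂(α.prod volume) = (∫⁻ u, w u ∂α) *
        (ENNReal.ofReal ((1 + 2 * (κ : ℝ))⁻¹ ^ (finrank ℝ E + 2)) * finrank ℝ L) := by
    rw [lintegral_prod_mul hwm.aemeasurable htw.aemeasurable, lintegral_tangentialWeight]
  rw [← hlim]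
  refine tendsto_lintegral_filter_of_dominated_convergence
    (fun z => w z.1 * tangentialWeight L κ z.2) ?_ ?_ ?_ ?_
  · exact .of_forall fun σ => by fun_prop
  · exact .of_forall fun σ => .of_forall fun z => mul_le_mul_left (min_le_left _ _) _
  · rw [hlim]
    exact ENNReal.mul_ne_top hfin (ENNReal.mul_ne_top ENNReal.ofReal_ne_top (by simp))
  · refine .of_forall fun z => ?_
    refine ENNReal.Tendsto.mul_const ?_ (.inr ?_)
    · have hto : Tendsto (fun σ : ℝ => z.1 + (2 * σ) • L.orthogonalProjectionOnto z.2) (𝓝[>] 0)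
          (𝓝 z.1) := by
        refine tendsto_nhdsWithin_of_tendsto_nhds ?_
        have : Continuous fun σ : ℝ => z.1 + (2 * σ) • L.orthogonalProjectionOnto z.2 := by fun_prop
        simpa using this.tendsto 0
      rw [tendsto_order]
      refine ⟨fun y hy => ?_, fun y hy => .of_forall fun σ => (min_le_left _ _).trans_lt hy⟩
      filter_upwards [hto.eventually (hw z.1 y hy)] with σ h using lt_min hy h
    · unfold tangentialWeight
      exact ENNReal.mul_ne_top ENNReal.ofReal_ne_top (by simp)

lemma eventually_lt_denoisingCost_tilt [α.IsAddHaarMeasure] (hg : LipschitzWith κ g)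
    (hκ : 2 * κ < 1) {w : L → ℝ≥0∞}
    (hw : LowerSemicontinuous w) (hfin : ∫⁻ u, w u ∂α ≠ ∞) {b : ℝ≥0∞}
    (hb : b < ENNReal.ofReal ((1 - κ) ^ 2) * ((∫⁻ u, w u ∂α) *
        (ENNReal.ofReal ((1 + 2 * (κ : ℝ))⁻¹ ^ (finrank ℝ E + 2)) * finrank ℝ L))) :
    ∀ᶠ σ in 𝓝[>] (0 : ℝ), ∀ h : E → E, Measurable h →
      b < (((1 - 2 * κ)⁻¹ : ℝ≥0) : ℝ≥0∞) ^ finrank ℝ E *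
        denoisingCost ((α.withDensity w).map (tilt g)) σ h := by
  have ht := ENNReal.Tendsto.const_mul (tendsto_lintegral_min (κ := κ) α hw hfin)
    (.inr (ENNReal.ofReal_ne_top (r := (1 - (κ : ℝ)) ^ 2)))
  filter_upwards [ht.eventually_const_lt hb, self_mem_nhdsWithin] with σ h1 hσ h hh
  exact h1.trans_le (lintegral_min_le_denoisingCost α hg hκ hw.measurable hh hσ)

end DenoisingCost

/-! ### Embedded submanifolds as locally tilted subspaces -/

section Chart

variable {n d : ℕ} {M : Set (Space n)}

/-- An embedded submanifold is the intersection of its closure with the union of the chart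
domains. -/
lemma IsEmbeddedSubmanifold.measurableSet (hM : IsEmbeddedSubmanifold d M) : MeasurableSet M := by
  choose Φ L hx _ _ _ hL using hM
  set W : Set (Space n) := ⋃ x : M, (Φ x x.2).source with hW
  have hWo : IsOpen W := isOpen_iUnion fun x => (Φ x x.2).open_source
  have hMW : M = W ∩ closure M := by
    refine Set.Subset.antisymm
      (fun x hxM => ⟨Set.mem_iUnion.2 ⟨⟨x, hxM⟩, hx x hxM⟩, subset_closure hxM⟩) ?_
    rintro y ⟨hyW, hyc⟩
    obtain ⟨⟨x, hxM⟩, hy⟩ := Set.mem_iUnion.1 hyW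
    rw [hL x hxM y hy]
    have hcl : IsClosed (L x hxM : Set (Space n)) := (L x hxM).closed_of_finiteDimensional
    refine hcl.mem_of_frequently_of_tendsto ?_ ((Φ x hxM).continuousAt hy)
    have hfr := mem_closure_iff_frequently.1 hyc
    refine (hfr.and_eventually ((Φ x hxM).open_source.mem_nhds hy)).mono ?_
    rintro z ⟨hzM, hz⟩
    exact (hL x hxM z hz).1 hzM
  rw [hMW]
  exact hWo.measurableSet.inter isClosed_closure.measurableSet

/-- Near each point the submanifold is parametrised by an arbitrarily small Lipschitz perturbation
of the inclusion of a linear subspace, namely of its tangent space: compose a slice chart with its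
derivative and use strict differentiability. -/
lemma IsEmbeddedSubmanifold.exists_tilt_image_eq (hM : IsEmbeddedSubmanifold d M) {x : Space n}
    (hx : x ∈ M) {κ : ℝ≥0} (hκ : 0 < κ) :
    ∃ (O : Set (Space n)) (L : Submodule ℝ (Space n)) (g : L → Space n) (D : Set L),
      IsOpen O ∧ x ∈ O ∧ finrank ℝ L = d ∧ LipschitzWith κ g ∧ IsOpen D ∧
        tilt g '' D = M ∩ O := by
  obtain ⟨Φ, L₀, hxs, hΦ, hΨ, hd, hL⟩ := hM x hx
  have hzt : Φ x ∈ Φ.target := Φ.map_source hxs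
  have hΦx : ContDiffAt ℝ 1 Φ x := hΦ.contDiffAt (Φ.open_source.mem_nhds hxs)
  have hΨz : ContDiffAt ℝ 1 Φ.symm (Φ x) := hΨ.contDiffAt (Φ.open_target.mem_nhds hzt)
  have hB := (hΦx.differentiableAt (by norm_num)).hasFDerivAt
  have hA := (hΨz.hasStrictFDerivAt (by norm_num))
  set B := fderiv ℝ Φ x
  set A₀ := fderiv ℝ Φ.symm (Φ x)
  have hAB : A₀.comp B = ContinuousLinearMap.id ℝ (Space n) := by
    refine (hA.hasFDerivAt.comp x hB).unique ((hasFDerivAt_id x).congr_of_eventuallyEq ?_)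
    filter_upwards [Φ.open_source.mem_nhds hxs] with y hy using Φ.left_inv hy
  have hBA : B.comp A₀ = ContinuousLinearMap.id ℝ (Space n) := by
    have hB' : HasFDerivAt Φ B (Φ.symm (Φ x)) := by rwa [Φ.left_inv hxs]
    refine (hB'.comp (Φ x) hA.hasFDerivAt).unique
      ((hasFDerivAt_id (Φ x)).congr_of_eventuallyEq ?_)
    filter_upwards [Φ.open_target.mem_nhds hzt] with y hy using Φ.right_inv hy
  let A : Space n ≃L[ℝ] Space n := ContinuousLinearEquiv.equivOfInverse A₀ B
    (fun v => DFunLike.congr_fun hBA v) (fun v => DFunLike.congr_fun hAB v)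
  have hAA : ∀ v, A₀ v = A v := fun _ => rfl
  set a : ℝ≥0 := ‖(A.symm : Space n →L[ℝ] Space n)‖₊
  set K : ℝ≥0 := lipschitzExtensionConstant (Space n)
  -- the accuracy of the linear approximation absorbs the loss `K` of the Lipschitz extension
  set c : ℝ≥0 := κ / (K * a + 1) with hc
  have hc0 : 0 < c := by positivity
  obtain ⟨s, hs, happ⟩ := hA.approximates_deriv_on_nhds (.inr hc0)
  obtain ⟨N, hNs, hNo, hzN⟩ := mem_nhds_iff.1 hs
  let L : Submodule ℝ (Space n) := L₀.map (A.toLinearEquiv : Space n →ₗ[ℝ] Space n)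
  let D : Set L := {u | A.symm (u : Space n) ∈ N ∩ Φ.target}
  have hlip : LipschitzOnWith (c * a) (fun u : L => Φ.symm (A.symm (u : Space n)) - u) D := by
    refine LipschitzOnWith.of_dist_le_mul fun u hu v hv => ?_
    rw [dist_eq_norm, dist_eq_norm, NNReal.coe_mul, mul_assoc]
    have h1 := happ _ (hNs hu.1) _ (hNs hv.1)
    have h2 : ‖A.symm (u : Space n) - A.symm (v : Space n)‖ ≤ a * ‖u - v‖ := by
      rw [← map_sub]
      exact (A.symm : Space n →L[ℝ] Space n).le_opNorm _
    rw [map_sub, hAA, hAA, A.apply_symm_apply, A.apply_symm_apply] at h1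
    calc _ = ‖Φ.symm (A.symm (u : Space n)) - Φ.symm (A.symm (v : Space n)) - (u - v)‖ := by
          congr 1; abel
      _ ≤ _ := h1.trans (by gcongr)
  obtain ⟨g, hg, hgD⟩ := hlip.extend_finite_dimension
  have hDt : ∀ u ∈ D, tilt g u = Φ.symm (A.symm (u : Space n)) := by
    intro u hu
    rw [tilt, ← hgD hu]
    exact add_sub_cancel _ _
  refine ⟨Φ.source ∩ Φ ⁻¹' N, L, g, D, Φ.isOpen_inter_preimage hNo, ⟨hxs, hzN⟩, ?_, ?_, ?_, ?_⟩
  · rw [← hd]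
    exact LinearEquiv.finrank_map_eq A.toLinearEquiv L₀
  · refine hg.weaken ?_
    calc K * (c * a) = κ * ((K * a) / (K * a + 1)) := by rw [hc]; ring
      _ ≤ κ * 1 := by
        gcongr
        exact div_le_one_of_le₀ (by simp) (by positivity)
      _ = κ := mul_one _
  · exact (hNo.inter Φ.open_target).preimage (A.symm.continuous.comp continuous_subtype_val)
  · ext y
    constructor
    · rintro ⟨u, hu, rfl⟩
      rw [hDt u hu]
      obtain ⟨v, hv, hvu⟩ := u.2
      have hvu' : A.symm (u : Space n) = v := by
        rw [← hvu]; exact A.symm_apply_apply v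
      have hsrc := Φ.map_target hu.2
      refine ⟨(hL _ hsrc).2 ?_, hsrc, ?_⟩
      · rw [Φ.right_inv hu.2, hvu']; exact hv
      · rw [Set.mem_preimage, Φ.right_inv hu.2]; exact hu.1
    · rintro ⟨hyM, hys, hyN⟩
      have hmem : A (Φ y) ∈ L := ⟨Φ y, (hL y hys).1 hyM, rfl⟩
      have huD : (⟨A (Φ y), hmem⟩ : L) ∈ D := by
        change A.symm (A (Φ y)) ∈ N ∩ Φ.target
        rw [A.symm_apply_apply]
        exact ⟨hyN, Φ.map_source hys⟩
      refine ⟨⟨A (Φ y), hmem⟩, huD, ?_⟩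
      rw [hDt _ huD]
      simp only [A.symm_apply_apply]
      exact Φ.left_inv hys

end Chart

/-! ### The denoising cost of the data law near a point -/

section Local

variable {n d : ℕ} {M : Set (Space n)} {p : Space n → ℝ≥0}

lemma measurable_indicator_density (hM : IsEmbeddedSubmanifold d M) (hp : ContinuousOn p M) :
    Measurable (M.indicator fun x => (p x : ℝ≥0∞)) := by
  classical
  rw [← Set.piecewise_eq_indicator]
  exact (ENNReal.continuous_coe.comp_continuousOn hp).measurable_piecewise continuousOn_const
    hM.measurableSet

lemma dataLaw_restrict (hM : IsEmbeddedSubmanifold d M) {O : Set (Space n)} (hO : IsOpen O) :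
    (dataLaw d M p).restrict O = ((μH[(d : ℝ)] : Measure (Space n)).restrict (M ∩ O)).withDensity
      (M.indicator fun x => (p x : ℝ≥0∞)) := by
  rw [dataLaw, restrict_withDensity hO.measurableSet, Measure.restrict_restrict hO.measurableSet,
    Set.inter_comm]
  refine withDensity_congr_ae ?_
  filter_upwards [ae_restrict_mem (hM.measurableSet.inter hO.measurableSet)] with x hx
  rw [Set.indicator_of_mem hx.1]

lemma withDensity_mono_of_measure_le {X : Type*} [MeasurableSpace X] {μ ν : Measure X} (h : μ ≤ ν)
    (f : X → ℝ≥0∞) : μ.withDensity f ≤ ν.withDensity f := by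
  refine Measure.le_iff.2 fun A hA => ?_
  rw [withDensity_apply _ hA, withDensity_apply _ hA]
  exact lintegral_mono' (Measure.restrict_mono le_rfl h) le_rfl

lemma map_withDensity_comp {X Y : Type*} [MeasurableSpace X] [MeasurableSpace Y] (μ : Measure X)
    {f : Y → ℝ≥0∞} (hf : Measurable f) {G : X → Y} (hG : Measurable G) :
    (μ.withDensity (f ∘ G)).map G = (μ.map G).withDensity f := by
  ext A hA
  rw [Measure.map_apply hG hA, withDensity_apply _ (hG hA), withDensity_apply _ hA,
    Measure.restrict_map hG hA, lintegral_map hf hG]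
  rfl

variable {L : Submodule ℝ (Space n)} {g : L → Space n} {κ : ℝ≥0}

lemma lipschitzWith_tilt (hg : LipschitzWith κ g) : LipschitzWith (1 + κ) (tilt g) :=
  (LipschitzWith.subtype_val (L : Set (Space n))).add hg

lemma antilipschitzWith_tilt (hg : LipschitzWith κ g) (hκ : κ < 1) :
    AntilipschitzWith (1 - κ)⁻¹ (tilt g) := by
  refine AntilipschitzWith.of_le_mul_dist fun u v => ?_
  have hκ' : (κ : ℝ) < 1 := by exact_mod_cast hκ
  rw [NNReal.coe_inv, NNReal.coe_sub hκ.le, NNReal.coe_one, ← div_eq_inv_mul,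
    le_div_iff₀ (by linarith), dist_eq_norm, dist_eq_norm, mul_comm]
  exact le_norm_tilt_sub hg u v

/-- The density on the parameter space `L` that corresponds to the density `p` on the part
of `M` lying in `O`, where `D` is the parameter domain. -/
noncomputable def pullbackDensity (M : Set (Space n)) (p : Space n → ℝ≥0) (g : L → Space n)
    (D : Set L) (O : Set (Space n)) : L → ℝ≥0∞ :=
  (D ∩ tilt g ⁻¹' O).indicator ((M.indicator fun x => (p x : ℝ≥0∞)) ∘ tilt g)

variable {D : Set L} {O O' : Set (Space n)}

lemma lowerSemicontinuous_pullbackDensity (hp : ContinuousOn p M) (hg : LipschitzWith κ g)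
    (hD : IsOpen D) (hDM : tilt g '' D = M ∩ O) (hO' : IsOpen O') :
    LowerSemicontinuous (pullbackDensity M p g D O') := by
  have hG := continuous_tilt hg
  have hD' : IsOpen (D ∩ tilt g ⁻¹' O') := hD.inter (hO'.preimage hG)
  have hmaps : Set.MapsTo (tilt g) (D ∩ tilt g ⁻¹' O') M := fun u hu =>
    (hDM ▸ Set.mem_image_of_mem (tilt g) hu.1 : tilt g u ∈ M ∩ O).1
  have hcont : ContinuousOn (fun u => (p (tilt g u) : ℝ≥0∞)) (D ∩ tilt g ⁻¹' O') :=
    ENNReal.continuous_coe.comp_continuousOn (hp.comp hG.continuousOn hmaps)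
  have hval : ∀ u ∈ D ∩ tilt g ⁻¹' O', pullbackDensity M p g D O' u = p (tilt g u) := by
    intro u hu
    rw [pullbackDensity, Set.indicator_of_mem hu, Function.comp_apply,
      Set.indicator_of_mem (hmaps hu)]
  intro u y hy
  by_cases hu : u ∈ D ∩ tilt g ⁻¹' O'
  · rw [hval u hu] at hy
    filter_upwards [(hcont.continuousAt (hD'.mem_nhds hu)).eventually_const_lt hy,
      hD'.mem_nhds hu] with v hv hvD
    rwa [hval v hvD]
  · rw [pullbackDensity, Set.indicator_of_notMem hu] at hy
    exact absurd hy (not_lt_zero)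

lemma image_tilt_inter (hDM : tilt g '' D = M ∩ O) (hO'O : O' ⊆ O) (B : Set (Space n)) :
    tilt g '' ((D ∩ tilt g ⁻¹' O') ∩ tilt g ⁻¹' B) = (M ∩ O') ∩ B := by
  ext y
  constructor
  · rintro ⟨u, ⟨⟨huD, huO⟩, huB⟩, rfl⟩
    exact ⟨⟨(hDM ▸ Set.mem_image_of_mem (tilt g) huD : tilt g u ∈ M ∩ O).1, huO⟩, huB⟩
  · rintro ⟨⟨hyM, hyO⟩, hyB⟩
    obtain ⟨u, huD, rfl⟩ : y ∈ tilt g '' D := hDM ▸ ⟨hyM, hO'O hyO⟩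
    exact ⟨u, ⟨⟨huD, hyO⟩, hyB⟩, rfl⟩

/-- Since `tilt g` is expanding up to the factor `1 - κ`, the pushforward of the Hausdorff measure
of the parameter domain is controlled by the Hausdorff measure of the submanifold. -/
lemma map_tilt_restrict_le (hg : LipschitzWith κ g) (hκ : κ < 1) (hD : IsOpen D)
    (hDM : tilt g '' D = M ∩ O) (hO' : IsOpen O') (hO'O : O' ⊆ O) :
    (((μH[(d : ℝ)] : Measure L).restrict (D ∩ tilt g ⁻¹' O')).map (tilt g)) ≤
      (((1 - κ)⁻¹ : ℝ≥0) : ℝ≥0∞) ^ d • (μH[(d : ℝ)] : Measure (Space n)).restrict (M ∩ O') := by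
  have hG := continuous_tilt hg
  have hD' : IsOpen (D ∩ tilt g ⁻¹' O') := hD.inter (hO'.preimage hG)
  refine Measure.le_iff.2 fun B hB => ?_
  rw [Measure.map_apply hG.measurable hB, Measure.restrict_apply (hG.measurable hB),
    Measure.smul_apply, Measure.restrict_apply hB, smul_eq_mul, Set.inter_comm, Set.inter_comm B,
    ← image_tilt_inter hDM hO'O, ← ENNReal.rpow_natCast]
  exact (antilipschitzWith_tilt hg hκ).le_hausdorffMeasure_image (by positivity) _

lemma hausdorffMeasure_restrict_le (hg : LipschitzWith κ g)
    (hDM : tilt g '' D = M ∩ O) (hO'O : O' ⊆ O) :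
    (μH[(d : ℝ)] : Measure (Space n)).restrict (M ∩ O') ≤ ((1 + κ : ℝ≥0) : ℝ≥0∞) ^ d •
      (((μH[(d : ℝ)] : Measure L).restrict (D ∩ tilt g ⁻¹' O')).map (tilt g)) := by
  have hG := continuous_tilt hg
  refine Measure.le_iff.2 fun B hB => ?_
  rw [Measure.smul_apply, Measure.map_apply hG.measurable hB,
    Measure.restrict_apply (hG.measurable hB), Measure.restrict_apply hB, smul_eq_mul,
    Set.inter_comm, Set.inter_comm (tilt g ⁻¹' B), ← image_tilt_inter hDM hO'O,
    ← ENNReal.rpow_natCast]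
  exact (lipschitzWith_tilt hg).hausdorffMeasure_image_le (by positivity) _

lemma map_withDensity_pullbackDensity (hM : IsEmbeddedSubmanifold d M) (hp : ContinuousOn p M)
    (hg : LipschitzWith κ g) (hD : IsOpen D) (hO' : IsOpen O') :
    ((μH[(d : ℝ)] : Measure L).withDensity (pullbackDensity M p g D O')).map (tilt g) =
      (((μH[(d : ℝ)] : Measure L).restrict (D ∩ tilt g ⁻¹' O')).map (tilt g)).withDensity
        (M.indicator fun x => (p x : ℝ≥0∞)) := by
  have hG := continuous_tilt hg
  have hD' : IsOpen (D ∩ tilt g ⁻¹' O') := hD.inter (hO'.preimage hG)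
  rw [pullbackDensity, withDensity_indicator hD'.measurableSet,
    map_withDensity_comp _ (measurable_indicator_density hM hp) hG.measurable]

lemma map_pullbackDensity_le (hM : IsEmbeddedSubmanifold d M) (hp : ContinuousOn p M)
    (hg : LipschitzWith κ g) (hκ : κ < 1) (hD : IsOpen D) (hDM : tilt g '' D = M ∩ O)
    (hO' : IsOpen O') (hO'O : O' ⊆ O) :
    ((μH[(d : ℝ)] : Measure L).withDensity (pullbackDensity M p g D O')).map (tilt g) ≤
      (((1 - κ)⁻¹ : ℝ≥0) : ℝ≥0∞) ^ d • (dataLaw d M p).restrict O' := by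
  rw [map_withDensity_pullbackDensity hM hp hg hD hO', dataLaw_restrict hM hO',
    ← withDensity_smul_measure]
  exact withDensity_mono_of_measure_le (map_tilt_restrict_le hg hκ hD hDM hO' hO'O) _

lemma dataLaw_apply_le (hM : IsEmbeddedSubmanifold d M) (hp : ContinuousOn p M)
    (hg : LipschitzWith κ g) (hD : IsOpen D) (hDM : tilt g '' D = M ∩ O)
    (hO' : IsOpen O') (hO'O : O' ⊆ O) :
    dataLaw d M p O' ≤ ((1 + κ : ℝ≥0) : ℝ≥0∞) ^ d *
      ∫⁻ u, pullbackDensity M p g D O' u ∂(μH[(d : ℝ)] : Measure L) := by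
  have h := withDensity_mono_of_measure_le (hausdorffMeasure_restrict_le (d := d) hg hDM hO'O)
    (M.indicator fun x => (p x : ℝ≥0∞)) Set.univ
  rwa [← dataLaw_restrict hM hO', withDensity_smul_measure,
    ← map_withDensity_pullbackDensity hM hp hg hD hO', Measure.restrict_apply_univ,
    Measure.smul_apply, Measure.map_apply (continuous_tilt hg).measurable .univ, Set.preimage_univ,
    withDensity_apply _ .univ, Measure.restrict_univ, smul_eq_mul] at h

/-- All constants of the local estimate tend to `1` as the Lipschitz constant tends to zero. -/
lemma exists_lipschitz_constant (n d : ℕ) {c : ℝ≥0} (hc : c < 1) :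
    ∃ κ : ℝ≥0, 0 < κ ∧ 2 * κ < 1 ∧
      (1 - 2 * κ)⁻¹ ^ n * (1 - κ)⁻¹ ^ d * (1 + κ) ^ d * c <
        (1 - κ) ^ 2 * (1 + 2 * κ)⁻¹ ^ (n + 2) := by
  have h1 : ContinuousAt
      (fun κ : ℝ≥0 => (1 - 2 * κ)⁻¹ ^ n * (1 - κ)⁻¹ ^ d * (1 + κ) ^ d * c) 0 := by
    have ha : ContinuousAt (fun κ : ℝ≥0 => (1 - 2 * κ)⁻¹) 0 :=
      ContinuousAt.inv₀ (by fun_prop) (by simp)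
    have hb : ContinuousAt (fun κ : ℝ≥0 => (1 - κ)⁻¹) 0 :=
      ContinuousAt.inv₀ (by fun_prop) (by simp)
    fun_prop
  have h2 : ContinuousAt (fun κ : ℝ≥0 => (1 - κ) ^ 2 * (1 + 2 * κ)⁻¹ ^ (n + 2)) 0 := by
    have ha : ContinuousAt (fun κ : ℝ≥0 => (1 + 2 * κ)⁻¹) 0 :=
      ContinuousAt.inv₀ (by fun_prop) (by simp)
    fun_prop
  have h3 : ∀ᶠ κ : ℝ≥0 in 𝓝 0, 2 * κ < 1 :=
    (continuous_const.mul continuous_id).continuousAt.eventually_lt continuousAt_const (by simp)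
  have h4 := h1.eventually_lt h2 (by simpa using hc)
  have h5 : ∀ᶠ κ : ℝ≥0 in 𝓝[>] 0, 0 < κ := self_mem_nhdsWithin
  obtain ⟨κ, ha, hb, hk⟩ := (h5.and ((h3.and h4).filter_mono nhdsWithin_le_nhds)).exists
  exact ⟨κ, ha, hb, hk⟩

/-- The local form of the denoising bound, uniform over the estimators: every point of the
submanifold has a neighbourhood such that the part of the data in any open subset of it contributes
asymptotically at least `d` times its mass. -/
lemma exists_isOpen_eventually_le_denoisingCost (hM : IsEmbeddedSubmanifold d M)
    (hp : ContinuousOn p M) [IsFiniteMeasure (dataLaw d M p)] {c : ℝ≥0} (hc : c < 1)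
    {x : Space n} (hx : x ∈ M) :
    ∃ O : Set (Space n), IsOpen O ∧ x ∈ O ∧ ∀ O' ⊆ O, IsOpen O' →
      ∀ᶠ σ in 𝓝[>] (0 : ℝ), ∀ h : Space n → Space n, Measurable h →
        c * d * dataLaw d M p O' ≤ denoisingCost ((dataLaw d M p).restrict O') σ h := by
  obtain ⟨κ, hκ0, hκ2, hθ⟩ := exists_lipschitz_constant n d hc
  have hκ1 : κ < 1 := lt_of_le_of_lt (by rw [two_mul]; exact le_add_self) hκ2
  obtain ⟨O, L, g, D, hO, hxO, hL, hg, hD, hDM⟩ := hM.exists_tilt_image_eq hx hκ0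
  refine ⟨O, hO, hxO, fun O' hO'O hO' => ?_⟩
  set μ := dataLaw d M p with hμ
  set w := pullbackDensity M p g D O' with hw
  have hw1 : LowerSemicontinuous w := lowerSemicontinuous_pullbackDensity hp hg hD hDM hO'
  have hle := map_pullbackDensity_le hM hp hg hκ1 hD hDM hO' hO'O
  have hmass := dataLaw_apply_le hM hp hg hD hDM hO' hO'O
  rw [← hμ] at hle hmass
  rw [← hw] at hle hmass
  have hα : (μH[(d : ℝ)] : Measure L).IsAddHaarMeasure := by
    rw [← hL]; infer_instance
  set α : Measure L := μH[(d : ℝ)] with hαdef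
  set W := ∫⁻ u, w u ∂α with hW
  have hWfin : W ≠ ∞ := by
    have h := hle Set.univ
    rw [Measure.map_apply (continuous_tilt hg).measurable .univ, Set.preimage_univ,
      withDensity_apply _ .univ, Measure.restrict_univ, Measure.smul_apply, smul_eq_mul] at h
    refine ne_top_of_le_ne_top (ENNReal.mul_ne_top (by finiteness) (measure_ne_top _ _)) h
  rcases Nat.eq_zero_or_pos d with hd0 | hdpos
  · exact .of_forall fun σ h _ => by simp [hd0]
  rcases eq_or_ne W 0 with hW0 | hW0
  · rw [hW0, mul_zero, nonpos_iff_eq_zero] at hmass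
    exact .of_forall fun σ h _ => by simp [hmass]
  set C : ℝ≥0∞ := (((1 - 2 * κ)⁻¹ : ℝ≥0) : ℝ≥0∞) ^ n with hC
  set C₁ : ℝ≥0∞ := (((1 - κ)⁻¹ : ℝ≥0) : ℝ≥0∞) ^ d with hC₁
  have hCne : C ≠ 0 := by
    simp only [hC, ne_eq, pow_eq_zero_iff', ENNReal.coe_eq_zero, inv_eq_zero, not_and_or]
    exact .inl (tsub_pos_of_lt hκ2).ne'
  have hC₁ne : C₁ ≠ 0 := by
    simp only [hC₁, ne_eq, pow_eq_zero_iff', ENNReal.coe_eq_zero, inv_eq_zero, not_and_or]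
    exact .inl (tsub_pos_of_lt hκ1).ne'
  have hθ' : C * C₁ * ((1 + κ : ℝ≥0) : ℝ≥0∞) ^ d * c <
      ENNReal.ofReal ((1 - κ) ^ 2) * ENNReal.ofReal ((1 + 2 * (κ : ℝ))⁻¹ ^ (n + 2)) := by
    have e1 : ENNReal.ofReal ((1 - κ) ^ 2) = (((1 - κ) ^ 2 : ℝ≥0) : ℝ≥0∞) := by
      rw [← ENNReal.ofReal_coe_nnreal, NNReal.coe_pow, NNReal.coe_sub hκ1.le, NNReal.coe_one]
    have e2 : ENNReal.ofReal ((1 + 2 * (κ : ℝ))⁻¹ ^ (n + 2)) =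
        (((1 + 2 * κ)⁻¹ ^ (n + 2) : ℝ≥0) : ℝ≥0∞) := by
      rw [← ENNReal.ofReal_coe_nnreal]; push_cast; rfl
    rw [e1, e2, hC, hC₁]
    exact_mod_cast hθ
  have hb : C * (C₁ * (c * d * μ O')) < ENNReal.ofReal ((1 - κ) ^ 2) * (W *
        (ENNReal.ofReal ((1 + 2 * (κ : ℝ))⁻¹ ^ (finrank ℝ (Space n) + 2)) * finrank ℝ L)) := by
    rw [hL, finrank_euclideanSpace_fin]
    calc C * (C₁ * (c * d * μ O'))
        ≤ C * (C₁ * (c * d * (((1 + κ : ℝ≥0) : ℝ≥0∞) ^ d * W))) := by gcongr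
      _ = (C * C₁ * ((1 + κ : ℝ≥0) : ℝ≥0∞) ^ d * c) * (d * W) := by ring
      _ < (ENNReal.ofReal ((1 - κ) ^ 2) * ENNReal.ofReal ((1 + 2 * (κ : ℝ))⁻¹ ^ (n + 2))) *
          (d * W) := by
        refine (ENNReal.mul_lt_mul_iff_left ?_ ?_).2 hθ'
        · exact mul_ne_zero (by exact_mod_cast hdpos.ne') hW0
        · exact ENNReal.mul_ne_top (by simp) hWfin
      _ = _ := by ring
  filter_upwards [eventually_lt_denoisingCost_tilt α hg hκ2 hw1 hWfin hb] with σ hσ h hh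
  have h1 := hσ h hh
  rw [finrank_euclideanSpace_fin, ← hC] at h1
  have h2 : denoisingCost ((α.withDensity w).map (tilt g)) σ h ≤
      C₁ * denoisingCost (μ.restrict O') σ h := by
    refine (denoisingCost_mono hle σ h).trans_eq ?_
    rw [denoisingCost, lintegral_smul_measure]; rfl
  have h3 : C * (C₁ * (c * d * μ O')) ≤ C * (C₁ * denoisingCost (μ.restrict O') σ h) :=
    h1.le.trans (by gcongr)
  rwa [ENNReal.mul_le_mul_iff_right hCne (by finiteness),
    ENNReal.mul_le_mul_iff_right hC₁ne (by finiteness)] at h3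

end Local

/-! ### The denoising cost of the data law -/

section Global

/-- A finite measure carried by `M` is exhausted, up to an arbitrarily small mass, by finitely many
disjoint open sets, each contained in a prescribed neighbourhood of some point of `M`. The sets are
obtained by disjointification from balls whose boundary spheres are null. -/
lemma exists_disjoint_isOpen_lt_sum {X : Type*} [MetricSpace X] [SecondCountableTopology X]
    [MeasurableSpace X] [BorelSpace X] {μ : Measure X} [IsFiniteMeasure μ] {M : Set X}
    (hM : μ Mᶜ = 0) {U : X → Set X} (hU : ∀ x ∈ M, IsOpen (U x) ∧ x ∈ U x) {b : ℝ≥0∞}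
    (hb : b < μ Set.univ) :
    ∃ (N : ℕ) (O : ℕ → Set X), Pairwise (Function.onFun Disjoint O) ∧
      (∀ i, IsOpen (O i) ∧ ∃ x ∈ M, O i ⊆ U x) ∧ b < ∑ i ∈ Finset.range N, μ (O i) := by
  have hr : ∀ x ∈ M, ∃ r, 0 < r ∧ Metric.closedBall x r ⊆ U x ∧
      μ (Metric.closedBall x r \ Metric.ball x r) = 0 := by
    intro x hx
    obtain ⟨R, hR, hRU⟩ := Metric.nhds_basis_closedBall.mem_iff.1
      ((hU x hx).1.mem_nhds (hU x hx).2)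
    have hsub : ∀ r, Metric.closedBall x r \ Metric.ball x r ⊆ (dist · x) ⁻¹' {r} := by
      rintro r y ⟨h1, h2⟩
      exact le_antisymm h1 (not_lt.1 h2)
    have hcount : {r : ℝ | 0 < μ ((dist · x) ⁻¹' {r})}.Countable :=
      Measure.countable_meas_pos_of_disjoint_iUnion
        (fun r => (by fun_prop : Measurable (dist · x)) (measurableSet_singleton r))
        (fun r r' hrr' => Disjoint.preimage _ (by simpa using hrr'))
    -- disjoint spheres: all but countably many radii give a null one
    obtain ⟨r, hr, hr'⟩ : ∃ r ∈ Set.Ioo 0 R, μ ((dist · x) ⁻¹' {r}) = 0 := by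
      by_contra! hcon
      have : Set.Ioo 0 R ⊆ {r : ℝ | 0 < μ ((dist · x) ⁻¹' {r})} := fun r hr =>
        pos_iff_ne_zero.2 (hcon r hr)
      exact absurd hR (not_lt.2 (Cardinal.Real.Ioo_countable_iff.1 (hcount.mono this)))
    exact ⟨r, hr.1, (Metric.closedBall_subset_closedBall hr.2.le).trans hRU,
      measure_mono_null (hsub r) hr'⟩
  choose! r hr0 hrU hrnull using hr
  obtain ⟨t, htM, htc, htcov⟩ := TopologicalSpace.countable_cover_nhdsWithin
    (f := fun x => Metric.ball x (r x)) (s := M)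
    (fun x hx => mem_nhdsWithin_of_mem_nhds (Metric.ball_mem_nhds x (hr0 x hx)))
  have htne : t.Nonempty := by
    rw [Set.nonempty_iff_ne_empty]
    rintro rfl
    have hM' : M = ∅ := by simpa using htcov
    rw [hM', Set.compl_empty] at hM
    rw [hM] at hb
    exact not_lt_zero hb
  obtain ⟨x, rfl⟩ := htc.exists_eq_range htne
  have hxM : ∀ i, x i ∈ M := fun i => htM (Set.mem_range_self i)
  set B : ℕ → Set X := fun i => Metric.ball (x i) (r (x i)) with hB
  set K : ℕ → Set X := fun i => Metric.closedBall (x i) (r (x i)) with hK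
  have hBK : ∀ i, B i ⊆ K i := fun i => Metric.ball_subset_closedBall
  set O : ℕ → Set X := fun i => B i \ ⋃ j ∈ Finset.range i, K j with hO
  have hOo : ∀ i, IsOpen (O i) := fun i => Metric.isOpen_ball.sdiff
    (isClosed_biUnion_finset fun j _ => Metric.isClosed_closedBall)
  have hdisj : Pairwise (Function.onFun Disjoint O) := by
    refine (pairwise_disjoint_on O).2 fun i j hij => Set.disjoint_left.2 fun y hyi hyj => ?_
    exact hyj.2 (Set.mem_biUnion (Finset.mem_coe.2 (Finset.mem_range.2 hij)) (hBK i hyi.1))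
  have hcov : μ (⋃ i, O i)ᶜ = 0 := by
    have hsub : (⋃ i, O i)ᶜ ⊆ Mᶜ ∪ ⋃ i, (K i \ B i) := by
      intro y hy
      by_contra hcon
      simp only [Set.mem_union, Set.mem_compl_iff, not_or, not_not, Set.mem_iUnion,
        not_exists] at hcon
      obtain ⟨hyM, hyS⟩ := hcon
      have hex : ∃ i, y ∈ K i := by
        obtain ⟨z, ⟨i, rfl⟩, hz⟩ := Set.mem_iUnion₂.1 (htcov hyM)
        exact ⟨i, hBK i hz⟩
      classical
      refine hy (Set.mem_iUnion.2 ⟨Nat.find hex, ?_, ?_⟩)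
      · by_contra hyB
        exact hyS _ ⟨Nat.find_spec hex, hyB⟩
      · simp only [Set.mem_iUnion, Finset.mem_range, not_exists]
        exact fun j hj => Nat.find_min hex hj
    refine measure_mono_null hsub (measure_union_null hM (measure_iUnion_null fun i => ?_))
    exact hrnull _ (hxM i)
  have htsum : b < ∑' i, μ (O i) := by
    rw [← measure_iUnion hdisj fun i => (hOo i).measurableSet]
    rwa [measure_congr (ae_eq_univ.2 hcov)]
  rw [ENNReal.tsum_eq_iSup_nat, lt_iSup_iff] at htsum
  obtain ⟨N, hN⟩ := htsum
  exact ⟨N, O, hdisj, fun i => ⟨hOo i, x i, hxM i,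
    Set.sdiff_subset.trans ((hBK i).trans (hrU _ (hxM i)))⟩, hN⟩

variable {n d : ℕ} {M : Set (Space n)} {p : Space n → ℝ≥0}

/-- Asymptotically no estimator removes the `d` tangential directions of the noise. -/
theorem eventually_le_denoisingCost_dataLaw (hM : IsEmbeddedSubmanifold d M)
    (hp : ContinuousOn p M) [IsProbabilityMeasure (dataLaw d M p)] {c : ℝ≥0} (hc : c < 1) :
    ∀ᶠ σ in 𝓝[>] (0 : ℝ), ∀ h : Space n → Space n, Measurable h →
      c * d ≤ denoisingCost (dataLaw d M p) σ h := by
  set μ := dataLaw d M p with hμ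
  -- one factor `√c` is spent on the local estimate, the other on the mass that is left out
  set c' := NNReal.sqrt c with hc'
  have hc1 : c' < 1 := by
    rw [hc', ← NNReal.sqrt_one]; exact NNReal.sqrt_lt_sqrt.2 hc
  have hcc : c' * c' = c := NNReal.mul_self_sqrt c
  have hloc : ∀ x ∈ M, ∃ O : Set (Space n), IsOpen O ∧ x ∈ O ∧ ∀ O' ⊆ O, IsOpen O' →
      ∀ᶠ σ in 𝓝[>] (0 : ℝ), ∀ h : Space n → Space n, Measurable h →
        c' * d * μ O' ≤ denoisingCost (μ.restrict O') σ h := fun x hx =>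
    exists_isOpen_eventually_le_denoisingCost hM hp hc1 hx
  choose! U hUo hxU hU using hloc
  have hcarr : μ Mᶜ = 0 := by
    rw [hμ, dataLaw, withDensity_apply _ hM.measurableSet.compl,
      Measure.restrict_restrict hM.measurableSet.compl]
    simp
  obtain ⟨N, O, hdisj, hO, hsum⟩ := exists_disjoint_isOpen_lt_sum hcarr
    (fun x hx => ⟨hUo x hx, hxU x hx⟩) (b := c')
    (by rw [measure_univ]; exact_mod_cast hc1)
  have hev : ∀ᶠ σ in 𝓝[>] (0 : ℝ), ∀ i ∈ Finset.range N, ∀ h : Space n → Space n, Measurable h →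
      c' * d * μ (O i) ≤ denoisingCost (μ.restrict (O i)) σ h := by
    rw [Filter.eventually_all_finset]
    intro i _
    obtain ⟨hOi, x, hx, hOx⟩ := hO i
    exact hU x hx (O i) hOx hOi
  filter_upwards [hev] with σ hσ h hh
  calc (c * d : ℝ≥0∞) = c' * d * c' := by rw [← hcc]; push_cast; ring
    _ ≤ c' * d * ∑ i ∈ Finset.range N, μ (O i) := by gcongr
    _ = ∑ i ∈ Finset.range N, c' * d * μ (O i) := Finset.mul_sum _ _ _
    _ ≤ ∑ i ∈ Finset.range N, denoisingCost (μ.restrict (O i)) σ h :=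
      Finset.sum_le_sum fun i hi => hσ i hi h hh
    _ = denoisingCost (μ.restrict (⋃ i ∈ Finset.range N, O i)) σ h := by
      unfold denoisingCost
      rw [lintegral_biUnion_finset (fun i _ j _ hij => hdisj hij)
        (fun i _ => (hO i).1.measurableSet)]
    _ ≤ denoisingCost μ σ h := denoisingCost_mono Measure.restrict_le_self σ h

end Global

/-! ### Stein's identity -/

section Stein

variable {n : ℕ}

lemma divergence_smul {φ : Space n → ℝ} {t : Space n → Space n} {x : Space n}
    (hφ : DifferentiableAt ℝ φ x) (ht : DifferentiableAt ℝ t x) :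
    divergence (fun y => φ y • t y) x = φ x * divergence t x + fderiv ℝ φ x (t x) := by
  have h1 : ∀ i : Fin n, (fderiv ℝ (fun y => φ y • t y) x (EuclideanSpace.single i 1)) i =
      φ x * (fderiv ℝ t x (EuclideanSpace.single i 1)) i +
        t x i * fderiv ℝ φ x (EuclideanSpace.single i 1) := by
    intro i
    rw [fderiv_fun_smul hφ ht]
    simp [mul_comm]
  have h2 : t x = ∑ i, t x i • EuclideanSpace.single i (1 : ℝ) := by
    have := (EuclideanSpace.basisFun (Fin n) ℝ).sum_repr (t x)
    simpa using this.symm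
  rw [divergence, Finset.sum_congr rfl fun i _ => h1 i, Finset.sum_add_distrib, ← Finset.mul_sum,
    divergence]
  congr 1
  conv_rhs => rw [h2, map_sum]
  simp

/-- The divergence theorem for compactly supported fields. Only the divergence, not the
individual partial derivatives, is assumed to be integrable. -/
lemma integral_divergence_eq_zero {F : Space n → Space n} (hF : Differentiable ℝ F)
    (hc : HasCompactSupport F) (hi : Integrable (divergence F)) :
    ∫ x, divergence F x = 0 := by
  obtain _ | m := n
  · simp [divergence]
  obtain ⟨R, hR⟩ := hc.isCompact.isBounded.subset_ball 0
  have hzero : ∀ x : Space (m + 1), ∀ i, R ≤ |x i| → x ∉ tsupport F := by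
    intro x i hxi hx
    have h1 : ‖x‖ < R := by simpa using hR hx
    exact absurd ((PiLp.norm_apply_le x i).trans_lt h1) (not_lt.2 hxi)
  have hF0 : ∀ x : Space (m + 1), ∀ i, R ≤ |x i| → F x = 0 := fun x i h =>
    image_eq_zero_of_notMem_tsupport (hzero x i h)
  have hd0 : ∀ x : Space (m + 1), ∀ i, R ≤ |x i| → divergence F x = 0 := by
    intro x i h
    have : fderiv ℝ F x = 0 := fderiv_of_notMem_tsupport ℝ (hzero x i h)
    simp [divergence, this]
  set e : Space (m + 1) ≃L[ℝ] (Fin (m + 1) → ℝ) := EuclideanSpace.equiv (Fin (m + 1)) ℝ with he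
  have hvol : MeasurePreserving e.symm volume volume := PiLp.volume_preserving_toLp (Fin (m + 1))
  have hemb : MeasurableEmbedding e.symm := e.symm.toHomeomorph.measurableEmbedding
  -- apply the theorem on the box `[-r, r]ⁿ`, on whose faces and outside of which `F` vanishes
  set r : ℝ := |R| with hr
  set a : Fin (m + 1) → ℝ := fun _ => -r with ha
  set b : Fin (m + 1) → ℝ := fun _ => r with hb
  have hab : a ≤ b := fun _ => by simp only [ha, hb]; linarith [abs_nonneg R]
  have hi' : Integrable (fun x => divergence F (e.symm x)) :=
    (hvol.integrable_comp_emb hemb).2 hi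
  set f' : Fin (m + 1) → (Fin (m + 1) → ℝ) → (Fin (m + 1) → ℝ) →L[ℝ] ℝ := fun i x =>
    (EuclideanSpace.proj i).comp ((fderiv ℝ F (e.symm x)).comp
      (e.symm : (Fin (m + 1) → ℝ) →L[ℝ] Space (m + 1))) with hf'
  have hdiv : ∀ x, ∑ i, f' i x (Pi.single i 1) = divergence F (e.symm x) := fun x => rfl
  have hder : ∀ i x, HasFDerivAt (fun y => F (e.symm y) i) (f' i x) x := by
    intro i x
    have h1 : HasFDerivAt (fun y => F (e.symm y)) ((fderiv ℝ F (e.symm x)).comp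
      (e.symm : (Fin (m + 1) → ℝ) →L[ℝ] Space (m + 1))) x :=
      (hF (e.symm x)).hasFDerivAt.comp x e.symm.hasFDerivAt
    exact (EuclideanSpace.proj (𝕜 := ℝ) i).hasFDerivAt.comp x h1
  have hmain := integral_divergence_of_hasFDerivAt_off_countable' a b hab
    (fun i y => F (e.symm y) i) f' ∅ Set.countable_empty
    (fun i x _ => (hder i x).continuousAt.continuousWithinAt) (fun x _ i => hder i x)
    (by simp_rw [hdiv]; exact hi'.integrableOn)
  have hRr : R ≤ |r| := by rw [hr, abs_abs]; exact le_abs_self R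
  have hface : ∀ (i : Fin (m + 1)) (c : ℝ) (y : Fin m → ℝ), |c| = |r| →
      F (e.symm (i.insertNth c y)) = 0 := by
    intro i c y hcr
    refine hF0 _ i ?_
    have : (e.symm (i.insertNth c y)) i = c := by simp [he]
    rw [this, hcr]
    exact hRr
  have hrhs : ∫ x in Set.Icc a b, divergence F (e.symm x) = 0 := by
    simp_rw [hdiv] at hmain
    rw [hmain]
    refine Finset.sum_eq_zero fun i _ => ?_
    simp only [hface i (b i) _ rfl, hface i (a i) _ (abs_neg r)]
    simp
  rw [← hvol.integral_comp hemb, ← hrhs, setIntegral_eq_integral_of_forall_compl_eq_zero]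
  intro x hx
  obtain ⟨i, hxi⟩ : ∃ i, r < |x i| := by
    by_contra! hcon
    exact hx ⟨fun i => (abs_le.1 (hcon i)).1, fun i => (abs_le.1 (hcon i)).2⟩
  exact hd0 _ i ((le_abs_self R).trans hxi.le)

lemma integrable_stdGaussian_iff {f : Space n → ℝ} :
    Integrable f (stdGaussian (Space n)) ↔ Integrable (fun x => gaussianDensity x * f x) := by
  rw [stdGaussian_eq_withDensity, integrable_withDensity_iff_integrable_smul'
    measurable_gaussianDensity.ennreal_ofReal (by simp)]
  simp [ENNReal.toReal_ofReal (gaussianDensity_pos _).le]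

lemma integral_stdGaussian (f : Space n → ℝ) :
    ∫ x, f x ∂(stdGaussian (Space n)) = ∫ x, gaussianDensity x * f x := by
  rw [stdGaussian_eq_withDensity, integral_withDensity_eq_integral_toReal_smul
    measurable_gaussianDensity.ennreal_ofReal (by simp)]
  simp [ENNReal.toReal_ofReal (gaussianDensity_pos _).le]

lemma hasFDerivAt_gaussianDensity (x : Space n) :
    HasFDerivAt (gaussianDensity (E := Space n)) (-(gaussianDensity x • innerSL ℝ x)) x := by
  unfold gaussianDensity
  have h1 : HasFDerivAt (fun y : Space n => -‖y‖ ^ 2 / 2) (-innerSL ℝ x) x := by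
    have h := ((hasStrictFDerivAt_norm_sq x).hasFDerivAt).const_mul (-1 / 2 : ℝ)
    refine (h.congr_fderiv ?_).congr_of_eventuallyEq (.of_forall fun y => by ring)
    ext v; simp; ring
  refine (h1.exp.const_mul _).congr_fderiv ?_
  ext v; simp; ring

/-- Integration by parts against the Gaussian with a compactly supported cutoff `χ`. -/
lemma integral_cutoff_stdGaussian {χ : Space n → ℝ} (hχ : ContDiff ℝ 1 χ)
    (hχc : HasCompactSupport χ)
    {t : Space n → Space n} (ht : Differentiable ℝ t)
    (hint : Integrable (fun x => χ x * (divergence t x - inner ℝ x (t x)) + fderiv ℝ χ x (t x))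
      (stdGaussian (Space n))) :
    ∫ x, χ x * (divergence t x - inner ℝ x (t x)) + fderiv ℝ χ x (t x)
      ∂(stdGaussian (Space n)) = 0 := by
  set φ : Space n → ℝ := fun x => gaussianDensity x * χ x with hφ
  have hχd : Differentiable ℝ χ := hχ.differentiable (by norm_num)
  have hφd : ∀ x, HasFDerivAt φ (gaussianDensity x • fderiv ℝ χ x +
      χ x • -(gaussianDensity x • innerSL ℝ x)) x := fun x =>
    (hasFDerivAt_gaussianDensity x).mul (hχd x).hasFDerivAt
  have hφ' : Differentiable ℝ φ := fun x => (hφd x).differentiableAt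
  have hdiv : ∀ x, divergence (fun y => φ y • t y) x = gaussianDensity x *
      (χ x * (divergence t x - inner ℝ x (t x)) + fderiv ℝ χ x (t x)) := by
    intro x
    rw [divergence_smul (hφ' x) (ht x), (hφd x).fderiv]
    simp [hφ]
    ring
  have hc : HasCompactSupport (fun y => φ y • t y) := (hχc.mul_left).smul_right
  rw [integral_stdGaussian]
  rw [integrable_stdGaussian_iff] at hint
  simp_rw [← hdiv] at hint ⊢
  exact integral_divergence_eq_zero (hφ'.smul ht) hc hint

lemma integrable_sq_norm_stdGaussian :
    Integrable (fun x => ‖x‖ ^ 2) (stdGaussian (Space n)) ∧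
      ∫ x, ‖x‖ ^ 2 ∂(stdGaussian (Space n)) = n := by
  have h := integrable_sq_norm_orthogonalProjectionOnto_stdGaussian (⊤ : Submodule ℝ (Space n))
  have htop : ∀ x : Space n, ‖(⊤ : Submodule ℝ (Space n)).orthogonalProjectionOnto x‖ = ‖x‖ := by
    intro x
    change ‖((⊤ : Submodule ℝ (Space n)).orthogonalProjectionOnto x : Space n)‖ = ‖x‖
    rw [← Submodule.starProjection_apply,
      Submodule.starProjection_eq_self_iff.2 Submodule.mem_top]
  simpa only [htop, finrank_top, finrank_euclideanSpace_fin] using h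

lemma integrable_inner_stdGaussian {t : Space n → Space n} (ht : Continuous t)
    (ht2 : Integrable (fun x => ‖t x‖ ^ 2) (stdGaussian (Space n))) :
    Integrable (fun x => (inner ℝ x (t x) : ℝ)) (stdGaussian (Space n)) := by
  refine (integrable_sq_norm_stdGaussian.1.add ht2).mono' (by fun_prop) (.of_forall fun x => ?_)
  have h := abs_real_inner_le_norm x (t x)
  rw [Real.norm_eq_abs, Pi.add_apply]
  nlinarith [sq_nonneg (‖x‖ - ‖t x‖), sq_nonneg (‖x‖), sq_nonneg ‖t x‖]

/-- **Stein's identity** for a differentiable field that is square integrable and has integrable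
divergence with respect to the standard Gaussian measure. -/
theorem integral_divergence_stdGaussian {t : Space n → Space n} (ht : Differentiable ℝ t)
    (ht2 : Integrable (fun x => ‖t x‖ ^ 2) (stdGaussian (Space n)))
    (hdiv : Integrable (divergence t) (stdGaussian (Space n))) :
    ∫ x, divergence t x ∂(stdGaussian (Space n)) =
      ∫ x, inner ℝ x (t x) ∂(stdGaussian (Space n)) := by
  set γ := stdGaussian (Space n) with hγ
  have hin := integrable_inner_stdGaussian ht.continuous ht2
  have ht1 : Integrable (fun x => ‖t x‖) γ := by
    refine ((integrable_const (1 : ℝ)).add ht2).mono' (by have := ht.continuous; fun_prop)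
      (.of_forall fun x => ?_)
    rw [norm_norm, Pi.add_apply]
    nlinarith [sq_nonneg (‖t x‖ - 1)]
  -- cutoffs `χ k` at scale `k + 1`, with gradient of order `1 / (k + 1)`
  let β : ContDiffBump (0 : Space n) := ⟨1, 2, one_pos, one_lt_two⟩
  have hβ : ContDiff ℝ 1 β := β.contDiff
  obtain ⟨C, hC⟩ := (hβ.continuous_fderiv (by norm_num)).bounded_above_of_compact_support
    (β.hasCompactSupport.fderiv ℝ)
  let a : ℕ → ℝ := fun k => 1 / ((k : ℝ) + 1)
  have ha0 : ∀ k, 0 < a k := fun k => Nat.one_div_pos_of_nat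
  have ha1 : ∀ k, a k ≤ 1 := fun k => by
    refine div_le_one_of_le₀ ?_ (by positivity)
    linarith [Nat.cast_nonneg (α := ℝ) k]
  have hat : Tendsto a atTop (𝓝 0) := tendsto_one_div_add_atTop_nhds_zero_nat
  let χ : ℕ → Space n → ℝ := fun k x => β (a k • x)
  have hχ : ∀ k, ContDiff ℝ 1 (χ k) := fun k => hβ.comp (contDiff_const_smul (a k))
  have hχc : ∀ k, HasCompactSupport (χ k) := fun k =>
    β.hasCompactSupport.comp_smul (ha0 k).ne'
  have hχ' : ∀ k x v, fderiv ℝ (χ k) x v = a k * fderiv ℝ β (a k • x) v := by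
    intro k x v
    have h1 : HasFDerivAt (χ k) ((fderiv ℝ β (a k • x)).comp
        (a k • ContinuousLinearMap.id ℝ (Space n))) x :=
      ((hβ.differentiable (by norm_num)) (a k • x)).hasFDerivAt.comp x
        ((hasFDerivAt_id x).const_smul (a k))
    rw [h1.fderiv]
    simp
  have hmeas : ∀ k, AEStronglyMeasurable
      (fun x => χ k x * (divergence t x - inner ℝ x (t x)) + fderiv ℝ (χ k) x (t x)) γ := by
    intro k
    have h1 := (hχ k).continuous
    have h2 : Continuous fun x => fderiv ℝ (χ k) x (t x) :=
      ((hχ k).continuous_fderiv (by norm_num)).clm_apply ht.continuous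
    exact (h1.aestronglyMeasurable.mul (hdiv.1.sub hin.1)).add h2.aestronglyMeasurable
  set bound : Space n → ℝ := fun x => |divergence t x - inner ℝ x (t x)| + C * ‖t x‖ with hbound
  have hbint : Integrable bound γ := (hdiv.sub hin).abs.add (ht1.const_mul C)
  have hder : ∀ k x, |fderiv ℝ (χ k) x (t x)| ≤ a k * (C * ‖t x‖) := by
    intro k x
    rw [hχ', abs_mul, abs_of_pos (ha0 k)]
    gcongr
    exact ((fderiv ℝ β (a k • x)).le_opNorm (t x)).trans (by gcongr; exact hC _)
  have hC0 : 0 ≤ C := (norm_nonneg _).trans (hC 0)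
  have hle : ∀ k x, ‖χ k x * (divergence t x - inner ℝ x (t x)) + fderiv ℝ (χ k) x (t x)‖ ≤
      bound x := by
    intro k x
    refine (norm_add_le _ _).trans (add_le_add ?_ ?_)
    · rw [norm_mul, Real.norm_eq_abs, Real.norm_eq_abs, abs_of_nonneg β.nonneg]
      exact mul_le_of_le_one_left (abs_nonneg _) β.le_one
    · exact (hder k x).trans (mul_le_of_le_one_left (by positivity) (ha1 k))
  have hlim : ∀ x, Tendsto
      (fun k => χ k x * (divergence t x - inner ℝ x (t x)) + fderiv ℝ (χ k) x (t x)) atTop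
      (𝓝 (divergence t x - inner ℝ x (t x))) := by
    intro x
    have h1 : Tendsto (fun k => χ k x) atTop (𝓝 1) := by
      have h : Tendsto (fun k => β (a k • x)) atTop (𝓝 (β ((0 : ℝ) • x))) :=
        (hβ.continuous.tendsto _).comp (hat.smul_const x)
      have hone : β ((0 : ℝ) • x) = 1 := β.one_of_mem_closedBall (by simp [β])
      rwa [hone] at h
    have h2 : Tendsto (fun k => fderiv ℝ (χ k) x (t x)) atTop (𝓝 0) := by
      refine squeeze_zero_norm (hder · x) ?_
      simpa using hat.mul_const (C * ‖t x‖)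
    simpa using (h1.mul_const (divergence t x - inner ℝ x (t x))).add h2
  have hconv := tendsto_integral_of_dominated_convergence bound hmeas hbint
    (fun k => .of_forall (hle k)) (.of_forall hlim)
  have hzero : ∀ k, ∫ x, χ k x * (divergence t x - inner ℝ x (t x)) + fderiv ℝ (χ k) x (t x) ∂γ
      = 0 := fun k =>
    integral_cutoff_stdGaussian (hχ k) (hχc k) ht (hbint.mono' (hmeas k) (.of_forall (hle k)))
  simp_rw [hzero] at hconv
  have h := tendsto_nhds_unique hconv tendsto_const_nhds
  rw [integral_sub hdiv hin] at h
  linarith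

end Stein

/-! ### The score matching losses -/

section ScoreLoss

variable {n : ℕ}

lemma integrable_noised {μ : Measure (Space n)} {σ : ℝ} {f : Space n → ℝ} [SFinite μ]
    (hf : Integrable f (noised μ σ)) :
    (∀ᵐ x ∂μ, Integrable (fun ε => f (x + σ • ε)) (stdGaussian (Space n))) ∧
      Integrable (fun x => ∫ ε, f (x + σ • ε) ∂(stdGaussian (Space n))) μ ∧
      ∫ y, f y ∂(noised μ σ) = ∫ x, ∫ ε, f (x + σ • ε) ∂(stdGaussian (Space n)) ∂μ := by
  have hmap : noised μ σ =
      (μ.prod (stdGaussian (Space n))).map (fun z : Space n × Space n => z.1 + σ • z.2) := by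
    have h1 : μ.prod ((stdGaussian (Space n)).map (fun ε => σ • ε)) =
        (μ.prod (stdGaussian (Space n))).map (Prod.map id (fun ε => σ • ε)) := by
      rw [← Measure.map_prod_map _ _ measurable_id (by fun_prop), Measure.map_id]
    rw [noised, Measure.conv, h1, Measure.map_map (by fun_prop) (by fun_prop)]
    rfl
  rw [hmap] at hf ⊢
  have hf' := (integrable_map_measure hf.1 (by fun_prop)).1 hf
  exact ⟨hf'.prod_right_ae, hf'.integral_prod_left,
    (integral_map (by fun_prop) hf.1).trans (integral_prod _ hf')⟩

lemma divergence_comp_affine {s : Space n → Space n} (hs : Differentiable ℝ s) (x : Space n)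
    (σ : ℝ) (ε : Space n) :
    divergence (fun e => s (x + σ • e)) ε = σ * divergence s (x + σ • ε) := by
  have h1 : HasFDerivAt (fun e => s (x + σ • e)) ((fderiv ℝ s (x + σ • ε)).comp
      (σ • ContinuousLinearMap.id ℝ (Space n))) ε :=
    (hs (x + σ • ε)).hasFDerivAt.comp ε (((hasFDerivAt_id ε).const_smul σ).const_add x)
  rw [divergence, h1.fderiv, divergence, Finset.mul_sum]
  simp

/-- Stein's identity turns the implicit score matching loss at a fixed base point into a denoising
error. -/
lemma integral_sq_norm_add_smul {s : Space n → Space n} (hs : Differentiable ℝ s) {σ : ℝ}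
    {x : Space n}
    (h2 : Integrable (fun ε => ‖s (x + σ • ε)‖ ^ 2) (stdGaussian (Space n)))
    (hd : Integrable (fun ε => divergence s (x + σ • ε)) (stdGaussian (Space n))) :
    Integrable (fun ε => ‖ε + σ • s (x + σ • ε)‖ ^ 2) (stdGaussian (Space n)) ∧
    ∫ ε, ‖ε + σ • s (x + σ • ε)‖ ^ 2 ∂(stdGaussian (Space n)) =
      n + 2 * ∫ ε, ismLoss s σ (x + σ • ε) ∂(stdGaussian (Space n)) := by
  set t : Space n → Space n := fun ε => s (x + σ • ε) with ht
  have htd : Differentiable ℝ t := hs.comp (by fun_prop)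
  obtain ⟨hx2, hxn⟩ := integrable_sq_norm_stdGaussian (n := n)
  have hin := integrable_inner_stdGaussian htd.continuous h2
  have hdt : ∀ ε, divergence t ε = σ * divergence s (x + σ • ε) := divergence_comp_affine hs x σ
  have hst := integral_divergence_stdGaussian htd h2 (by
    rw [funext hdt]; exact hd.const_mul σ)
  simp_rw [hdt] at hst
  rw [integral_const_mul] at hst
  have hexp : ∀ ε, ‖ε + σ • s (x + σ • ε)‖ ^ 2 =
      ‖ε‖ ^ 2 + 2 * σ * inner ℝ ε (t ε) + σ ^ 2 * ‖t ε‖ ^ 2 := by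
    intro ε
    rw [norm_add_sq_real, inner_smul_right, norm_smul, mul_pow, Real.norm_eq_abs, sq_abs]
    ring
  simp_rw [hexp]
  refine ⟨(hx2.add (hin.const_mul _)).add (h2.const_mul _), ?_⟩
  have hism : ∫ ε, ismLoss s σ (x + σ • ε) ∂(stdGaussian (Space n)) =
      σ ^ 2 * (∫ ε, divergence s (x + σ • ε) ∂(stdGaussian (Space n)) +
        1 / 2 * ∫ ε, ‖t ε‖ ^ 2 ∂(stdGaussian (Space n))) := by
    unfold ismLoss
    rw [integral_const_mul, integral_add hd (h2.const_mul _), integral_const_mul]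
  have hsum : ∫ ε, ‖ε‖ ^ 2 + 2 * σ * inner ℝ ε (t ε) + σ ^ 2 * ‖t ε‖ ^ 2
      ∂(stdGaussian (Space n)) = ∫ ε, ‖ε‖ ^ 2 + 2 * σ * inner ℝ ε (t ε) ∂(stdGaussian (Space n)) +
        ∫ ε, σ ^ 2 * ‖t ε‖ ^ 2 ∂(stdGaussian (Space n)) :=
    integral_add (hx2.add (hin.const_mul _)) (h2.const_mul _)
  rw [hsum, integral_add hx2 (hin.const_mul _), integral_const_mul, integral_const_mul, hxn, ← hst,
    hism]
  ring

/-- The expected implicit score matching loss is, up to affine normalisation, the denoising cost of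
the estimator `σ s`. -/
lemma denoisingCost_eq_ofReal_integral_ismLoss {μ : Measure (Space n)} [IsProbabilityMeasure μ]
    {σ : ℝ} (hσ : 0 < σ) {s : Space n → Space n} (hs : Differentiable ℝ s)
    (hism : Integrable (ismLoss s σ) (noised μ σ)) (hfl : Integrable (flipd s σ) (noised μ σ)) :
    0 ≤ n + 2 * ∫ y, ismLoss s σ y ∂(noised μ σ) ∧
    denoisingCost μ σ (fun y => σ • s y) =
      ENNReal.ofReal (n + 2 * ∫ y, ismLoss s σ y ∂(noised μ σ)) := by
  have hσ2 : σ ^ 2 ≠ 0 := by positivity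
  have : IsProbabilityMeasure ((stdGaussian (Space n)).map (fun ε => σ • ε)) :=
    Measure.isProbabilityMeasure_map (by fun_prop)
  have : IsProbabilityMeasure (noised μ σ) := by unfold noised; infer_instance
  -- the squared norm and the divergence are combinations of the two integrable losses
  have h2 : Integrable (fun y => ‖s y‖ ^ 2) (noised μ σ) := by
    refine (((hfl.sub hism).sub (integrable_const (n : ℝ))).const_mul (2 / σ ^ 2)).congr
      (.of_forall fun y => ?_)
    simp only [Pi.sub_apply, flipd]
    field_simp
    ring
  have hd : Integrable (divergence s) (noised μ σ) := by
    refine ((hism.const_mul (1 / σ ^ 2)).sub (h2.const_mul (1 / 2))).congr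
      (.of_forall fun y => ?_)
    simp only [Pi.sub_apply, ismLoss]
    field_simp
    ring
  obtain ⟨h2ae, -, -⟩ := integrable_noised h2
  obtain ⟨hdae, -, -⟩ := integrable_noised hd
  obtain ⟨-, hi, hieq⟩ := integrable_noised hism
  have hinner : ∀ᵐ x ∂μ, ∫⁻ ε, ‖ε + σ • s (x + σ • ε)‖ₑ ^ 2 ∂(stdGaussian (Space n)) =
      ENNReal.ofReal (n + 2 * ∫ ε, ismLoss s σ (x + σ • ε) ∂(stdGaussian (Space n))) ∧
      0 ≤ n + 2 * ∫ ε, ismLoss s σ (x + σ • ε) ∂(stdGaussian (Space n)) := by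
    filter_upwards [h2ae, hdae] with x hx2 hxd
    obtain ⟨h, he⟩ := integral_sq_norm_add_smul hs hx2 hxd
    rw [← he, ofReal_integral_eq_lintegral_ofReal h (.of_forall fun _ => by positivity)]
    refine ⟨lintegral_congr fun ε => ?_, by positivity⟩
    rw [ENNReal.ofReal_pow (norm_nonneg _), ofReal_norm]
  have hint : ∫ x, (n + 2 * ∫ ε, ismLoss s σ (x + σ • ε) ∂(stdGaussian (Space n))) ∂μ =
      n + 2 * ∫ y, ismLoss s σ y ∂(noised μ σ) := by
    rw [integral_add (integrable_const _) (hi.const_mul 2), integral_const_mul, hieq]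
    simp
  rw [← hint, denoisingCost, lintegral_congr_ae (hinner.mono fun _ h => h.1)]
  exact ⟨integral_nonneg_of_ae (hinner.mono fun _ h => h.2),
    (ofReal_integral_eq_lintegral_ofReal ((integrable_const _).add (hi.const_mul 2))
      (hinner.mono fun _ h => h.2)).symm⟩

lemma integral_ismLoss_add_le {μ : Measure (Space n)} [IsProbabilityMeasure μ]
    {σ : ℝ} {s : Space n → Space n}
    (hism : Integrable (ismLoss s σ) (noised μ σ)) (hfl : Integrable (flipd s σ) (noised μ σ)) :
    ∫ y, ismLoss s σ y ∂(noised μ σ) + n ≤ ∫ y, flipd s σ y ∂(noised μ σ) := by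
  have : IsProbabilityMeasure ((stdGaussian (Space n)).map (fun ε => σ • ε)) :=
    Measure.isProbabilityMeasure_map (by fun_prop)
  have : IsProbabilityMeasure (noised μ σ) := by unfold noised; infer_instance
  have h : ∫ y, (ismLoss s σ y + n) ∂(noised μ σ) = ∫ y, ismLoss s σ y ∂(noised μ σ) + n := by
    rw [integral_add hism (integrable_const _)]; simp
  rw [← h]
  refine integral_mono (hism.add (integrable_const _)) hfl fun y => ?_
  simp only [flipd]
  have : 0 ≤ σ ^ 2 / 2 * ‖s y‖ ^ 2 := by positivity
  linarith

/-- The dimension of a submanifold carrying a probability measure is at most that of the ambient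
space; nonemptiness is what matters, as the empty set is a submanifold of every dimension. -/
lemma IsEmbeddedSubmanifold.dim_le {d : ℕ} {M : Set (Space n)} (hM : IsEmbeddedSubmanifold d M)
    {p : Space n → ℝ≥0} [hprob : IsProbabilityMeasure (dataLaw d M p)] : d ≤ n := by
  rcases M.eq_empty_or_nonempty with rfl | ⟨x, hx⟩
  · exact absurd hprob.measure_univ (by simp [dataLaw])
  · obtain ⟨-, L, -, -, -, hL, -⟩ := hM x hx
    have h := Submodule.finrank_le L
    rwa [hL, finrank_euclideanSpace_fin] at h

/-- For every tolerance, at small noise levels the expected losses of all admissible scores satisfy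
the lower bounds with `(n - d) / 2` in place of `n - d`. -/
theorem exists_forall_integral_losses_ge {d : ℕ} {M : Set (Space n)}
    (hM : IsEmbeddedSubmanifold d M) {p : Space n → ℝ≥0} (hp : ContinuousOn p M)
    [IsProbabilityMeasure (dataLaw d M p)] {δ : ℝ} (hδ : 0 < δ) :
    ∃ σ₀ : ℝ, 0 < σ₀ ∧ ∀ σ : ℝ, 0 < σ → σ < σ₀ → ∀ s : Space n → Space n, Differentiable ℝ s →
      Integrable (ismLoss s σ) (noised (dataLaw d M p) σ) →
      Integrable (flipd s σ) (noised (dataLaw d M p) σ) →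
      ∫ y, ismLoss s σ y ∂(noised (dataLaw d M p) σ) + n ≤
        ∫ y, flipd s σ y ∂(noised (dataLaw d M p) σ) ∧
      -((n : ℝ) - d) / 2 - δ ≤ ∫ y, ismLoss s σ y ∂(noised (dataLaw d M p) σ) := by
  -- any `c < 1` with `(1 - c) d ≤ 2 δ` would do
  set c : ℝ≥0 := ⟨(d + 1) / (d + 1 + 2 * δ), by positivity⟩ with hc
  have hcr : (c : ℝ) = (d + 1) / (d + 1 + 2 * δ) := rfl
  have hc1 : c < 1 := by
    rw [← NNReal.coe_lt_coe, hcr, NNReal.coe_one, div_lt_one (by positivity)]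
    linarith
  have hcd : (d : ℝ) - 2 * δ ≤ c * d := by
    rw [hcr, div_mul_eq_mul_div, le_div_iff₀ (by positivity)]
    nlinarith [sq_nonneg δ]
  obtain ⟨σ₀, hσ₀, hσ⟩ := mem_nhdsGT_iff_exists_Ioo_subset.1
    (eventually_le_denoisingCost_dataLaw hM hp hc1)
  refine ⟨σ₀, hσ₀, fun σ h0 h1 s hs hism hfl =>
    ⟨integral_ismLoss_add_le hism hfl, ?_⟩⟩
  have h := hσ ⟨h0, h1⟩ (fun y => σ • s y) (hs.continuous.const_smul σ).measurable
  obtain ⟨hnonneg, heq⟩ := denoisingCost_eq_ofReal_integral_ismLoss h0 hs hism hfl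
  have hnn : (c * d : ℝ≥0∞) = ENNReal.ofReal (c * d) := by
    rw [ENNReal.ofReal_mul (by positivity), ENNReal.ofReal_coe_nnreal, ENNReal.ofReal_natCast]
  rw [heq, hnn, ENNReal.ofReal_le_ofReal_iff hnonneg] at h
  linarith

end ScoreLoss

end ScoreMatching

theorem mainTheorem3 (n d : ℕ) (M : Set (ScoreMatching.Space n))
    (hM : ScoreMatching.IsEmbeddedSubmanifold d M)
    (p : ScoreMatching.Space n → ℝ≥0) (hp : ContinuousOn p M)
    (hprob : IsProbabilityMeasure (ScoreMatching.dataLaw d M p)) :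
    (d < n → ∃ σ₀ : ℝ, 0 < σ₀ ∧ ∀ σ : ℝ, 0 < σ → σ < σ₀ →
      ∀ s : ScoreMatching.Space n → ScoreMatching.Space n, Differentiable ℝ s →
        Integrable (ScoreMatching.ismLoss s σ)
          (ScoreMatching.noised (ScoreMatching.dataLaw d M p) σ) →
        Integrable (ScoreMatching.flipd s σ)
          (ScoreMatching.noised (ScoreMatching.dataLaw d M p) σ) →
        (∫ y, ScoreMatching.ismLoss s σ y
            ∂(ScoreMatching.noised (ScoreMatching.dataLaw d M p) σ)) + (n : ℝ)
          ≤ ∫ y, ScoreMatching.flipd s σ y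
            ∂(ScoreMatching.noised (ScoreMatching.dataLaw d M p) σ) ∧
        -((n : ℝ) - (d : ℝ))
          ≤ ∫ y, ScoreMatching.ismLoss s σ y
            ∂(ScoreMatching.noised (ScoreMatching.dataLaw d M p) σ) ∧
        (d : ℝ)
          ≤ ∫ y, ScoreMatching.flipd s σ y
            ∂(ScoreMatching.noised (ScoreMatching.dataLaw d M p) σ)) ∧
    (∀ δ : ℝ, 0 < δ → ∃ σ₀ : ℝ, 0 < σ₀ ∧ ∀ σ : ℝ, 0 < σ → σ < σ₀ →
      ∀ s : ScoreMatching.Space n → ScoreMatching.Space n, Differentiable ℝ s →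
        Integrable (ScoreMatching.ismLoss s σ)
          (ScoreMatching.noised (ScoreMatching.dataLaw d M p) σ) →
        Integrable (ScoreMatching.flipd s σ)
          (ScoreMatching.noised (ScoreMatching.dataLaw d M p) σ) →
        (∫ y, ScoreMatching.ismLoss s σ y
            ∂(ScoreMatching.noised (ScoreMatching.dataLaw d M p) σ)) + (n : ℝ)
          ≤ ∫ y, ScoreMatching.flipd s σ y
            ∂(ScoreMatching.noised (ScoreMatching.dataLaw d M p) σ) ∧
        -((n : ℝ) - (d : ℝ)) - δ
          ≤ ∫ y, ScoreMatching.ismLoss s σ y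
            ∂(ScoreMatching.noised (ScoreMatching.dataLaw d M p) σ) ∧
        (d : ℝ) - δ
          ≤ ∫ y, ScoreMatching.flipd s σ y
            ∂(ScoreMatching.noised (ScoreMatching.dataLaw d M p) σ)) := by
  have hdn : d ≤ n := hM.dim_le (p := p)
  constructor
  · intro hlt
    have hlt' : (d : ℝ) < n := by exact_mod_cast hlt
    -- the bound `-(n - d) / 2 - δ` leaves room for `δ = (n - d) / 2` when `d < n`
    obtain ⟨σ₀, hσ₀, h⟩ := ScoreMatching.exists_forall_integral_losses_ge hM hp
      (δ := ((n : ℝ) - d) / 2) (by linarith)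
    refine ⟨σ₀, hσ₀, fun σ h0 h1 s hs hism hfl => ?_⟩
    obtain ⟨ha, hb⟩ := h σ h0 h1 s hs hism hfl
    exact ⟨ha, by linarith, by linarith⟩
  · intro δ hδ
    have hdn' : (d : ℝ) ≤ n := by exact_mod_cast hdn
    obtain ⟨σ₀, hσ₀, h⟩ := ScoreMatching.exists_forall_integral_losses_ge hM hp hδ
    refine ⟨σ₀, hσ₀, fun σ h0 h1 s hs hism hfl => ?_⟩
    obtain ⟨ha, hb⟩ := h σ h0 h1 s hs hism hfl
    exact ⟨ha, by linarith, by linarith⟩
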